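/- **Setting.** Let $M$ be a smooth (Hausdorff) $n$-manifold with a Carnot structure of step $r\ge 1$, i.e. a filtration of smooth subbundles $H_1\subset H_2\subset\cdots\subset H_r=TM$ (of constant ranks) such that $[H_v,H_{v'}]\subset H_{v+v'}$ whenever $v+v'\le r$. Its weight sequence is $w_j=\min\{v\in\{1,\dots,r\}: j\le \operatorname{rk}H_v\}$, $1\le j\le n$. Let $a\in M$, let $x=(x_1,\dots,x_n)$ be smooth local coordinates centered at $a$ with domain $V\subset M$ and range $U\subset\mathbb{R}^n$, and let $(X_1,\dots,X_n)$ be an $H$-frame over $V$, i.e. a smooth tangent frame such that each $X_j$ is a section of $H_{w_j}$. In the coordinates $x$ we regard the $X_j$ as vector fields on $U$. The coordinates are *linearly adapted* to $(X_1,\dots,X_n)$ at $a$ if $X_j(0)=\partial_j$ for all $j$. For $\alpha\in\mathbb{N}_0^n$ put $\langle\alpha\rangle=\sum_j w_j\alpha_j$ and $X^\alpha=X_1^{\alpha_1}\cdots X_n^{\alpha_n}$. For $t\ne 0$ put $\delta_t(x)=(t^{w_1}x_1,\dots,t^{w_n}x_n)$. * A smooth function $f$ near $a$ has *order $N$* at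 $a$ if $X_{i_1}\cdots X_{i_k}f(a)=0$ for every finite sequence (possibly empty) with $w_{i_1}+\cdots+w_{i_k}<N$, and $X_{i_1}\cdots X_{i_k}f(a)\neq0$ for some sequence with $w_{i_1}+\cdots+w_{i_k}=N$. * A smooth function $f$ near $0\in\mathbb{R}^n$ has *weight $\ge N$* ($N\in\mathbb{Z}$) if $\partial^\alpha f(0)=0$ whenever $\langle\alpha\rangle<N$; it has *weight $N$* if moreover $\partial^\alpha f(0)\ne0$ for some $\alpha$ with $\langle\alpha\rangle=N$. * A differential operator $P=\sum_{|\alpha|\le m}a_\alpha(x)\partial^\alpha$ with coefficients in $C^\infty(U)$ has *weight $N\in\mathbb{Z}$* if every $a_\alpha$ has weight $\ge N+\langle\alpha\rangle$ and at least one $a_\alpha$ has weight $N+\langle\alpha\rangle$. * A smooth vector field $Z$ on $\mathbb{R}^n$ is *homogeneous of degree $d$* if $\delta_t^*Z=t^dZ$ for all $t\in\mathbb{R}\setminus\{0\}$. The coordinates are *privileged coordinates* at $a$ adapted to $(X_1,\dots,X_n)$ (in the sense of Bellaïche–Stefani) if they are linearly adapted and each coordinate function $x_k$ has order $w_k$ at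 $a$. **Theorem 5.1.** Assume that the coordinates are linearly adapted to $(X_1,\dots,X_n)$ at $a$. Then the following are equivalent: 1. The coordinates $(x_1,\dots,x_n)$ are privileged coordinates at $a$. 2. For each $j=1,\dots,n$ there is a smooth vector field $X_j^{(a)}$ on $\mathbb{R}^n$, homogeneous of degree $-w_j$, such that, as $t\to0$, $t\neq 0$, $$t^{w_j}\delta_t^*X_j=X_j^{(a)}+\mathrm{O}(t)$$ in the $C^\infty$ topology of vector fields on $U$, i.e. for every compact $K\subset U$ and every $\alpha\in\mathbb{N}_0^n$, the $\partial^\alpha$-derivatives of the components of $t^{w_j}\delta_t^*X_j-X_j^{(a)}$ are $\mathrm{O}(t)$ uniformly on $K$. 3. For each $j=1,\dots,n$, the vector field $X_j$ has weight $-w_j$ in the coordinates $(x_1,\dots,x_n)$. 4. For every $\alpha\in\mathbb{N}_0^n$, the differential operator $X^\alpha$ has weight $-\langle\alpha\rangle$ in the coordinates $(x_1,\dots,x_n)$. Consequently (for arbitrary local coordinates centered at $a$), the coordinates are privileged in the sense of Bellaïche–Stefani if and only if they are privileged in the sense of Goodman, i.e. linearly adapted and satisfying condition 2. -/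

import Mathlib

open scoped Manifold ContDiff Topology

noncomputable section

namespace Carnot

/-- The model space `ℝⁿ`. -/
abbrev Rn (n : ℕ) : Type := EuclideanSpace ℝ (Fin n)

/-! ### Iterated operators -/

/-- The ordered monomial `D₁^{α₁} ∘ ⋯ ∘ Dₙ^{αₙ}` in a family of operators. -/
def monomial {n : ℕ} {F : Type*} (D : Fin n → F → F) (α : Fin n → ℕ) : F → F :=
  (List.ofFn fun i => (D i)^[α i]).foldr (fun S T => S ∘ T) id

/-- A vector field `Y` on (an open subset of) `ℝⁿ` acting on functions: `(Y u)(x) = du(x)(Y(x))`. -/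
def vfOp {n : ℕ} (Y : Rn n → Rn n) (u : Rn n → ℝ) : Rn n → ℝ :=
  fun x => fderiv ℝ u x (Y x)

/-- The iterated partial derivative `∂^α = ∂₁^{α₁} ⋯ ∂ₙ^{αₙ}`. -/
def partialDeriv {n : ℕ} (α : Fin n → ℕ) : (Rn n → ℝ) → Rn n → ℝ :=
  monomial (fun i => vfOp fun _ => EuclideanSpace.single i (1 : ℝ)) α

/-- The multi-orders `α ∈ ℕ₀ⁿ` with `|α| = α₁ + ⋯ + αₙ ≤ m`. -/
def multiOrders (n m : ℕ) : Finset (Fin n → ℕ) :=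
  (Fintype.piFinset fun _ => Finset.range (m + 1)).filter fun α => ∑ i, α i ≤ m

theorem mem_multiOrders {n m : ℕ} {α : Fin n → ℕ} :
    α ∈ multiOrders n m ↔ ∑ i, α i ≤ m := by
  simp only [multiOrders, Finset.mem_filter, Fintype.mem_piFinset, Finset.mem_range,
    and_iff_right_iff_imp]
  intro h i
  exact Nat.lt_succ_of_le
    ((Finset.single_le_sum (f := α) (fun _ _ => Nat.zero_le _) (Finset.mem_univ i)).trans h)

/-- The weighted length `⟨α⟩ = w₁ α₁ + ⋯ + wₙ αₙ`. -/
def wlen {n : ℕ} (w : Fin n → ℕ) (α : Fin n → ℕ) : ℕ := ∑ i, w i * α i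

/-! ### Anisotropic weights on `ℝⁿ` -/

/-- A function defined near `0` has weight `≥ N`: `∂^α f(0) = 0` whenever `⟨α⟩ < N`.
For `N ≤ 0` this holds for every function. -/
def WeightGE {n : ℕ} (w : Fin n → ℕ) (f : Rn n → ℝ) (N : ℤ) : Prop :=
  ∀ α : Fin n → ℕ, (wlen w α : ℤ) < N → partialDeriv α f 0 = 0

/-- A function defined near `0` has weight (exactly) `N`. -/
def HasWeight {n : ℕ} (w : Fin n → ℕ) (f : Rn n → ℝ) (N : ℤ) : Prop :=
  WeightGE w f N ∧ ∃ α : Fin n → ℕ, (wlen w α : ℤ) = N ∧ partialDeriv α f 0 ≠ 0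

/-- `P = ∑_{|α| ≤ m} a_α ∂^α` as operators on `C^∞(U)`, with coefficients `a_α ∈ C^∞(U)`. -/
def IsDiffOpOn {n : ℕ} (U : Set (Rn n)) (m : ℕ) (a : (Fin n → ℕ) → Rn n → ℝ)
    (P : (Rn n → ℝ) → Rn n → ℝ) : Prop :=
  (∀ α ∈ multiOrders n m, ContDiffOn ℝ ∞ (a α) U) ∧
  ∀ u : Rn n → ℝ, ContDiffOn ℝ ∞ u U → ∀ x ∈ U,
    P u x = ∑ α ∈ multiOrders n m, a α x * partialDeriv α u x

/-- `P` is a differential operator on the open set `U ∋ 0` which has weight `N`: in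
`P = ∑_{|α| ≤ m} a_α ∂^α`, every coefficient `a_α` has weight `≥ N + ⟨α⟩` and at least one of them
has weight `N + ⟨α⟩`. (The coefficients are uniquely determined by `P` on `U`.) -/
def DiffOpHasWeight {n : ℕ} (w : Fin n → ℕ) (U : Set (Rn n))
    (P : (Rn n → ℝ) → Rn n → ℝ) (N : ℤ) : Prop :=
  ∃ (m : ℕ) (a : (Fin n → ℕ) → Rn n → ℝ), IsDiffOpOn U m a P ∧
    (∀ α ∈ multiOrders n m, WeightGE w (a α) (N + wlen w α)) ∧
    ∃ α ∈ multiOrders n m, HasWeight w (a α) (N + wlen w α)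

/-- The dilation `δ_t(x) = t · x = (t^{w₁} x₁, …, t^{wₙ} xₙ)`. -/
def dilation {n : ℕ} (w : Fin n → ℕ) (t : ℝ) (x : Rn n) : Rn n :=
  WithLp.toLp 2 fun k => t ^ w k * x k

/-- A vector field `Z` on `ℝⁿ` is homogeneous of degree `d`: `δ_t^* Z = t^d Z` for all `t ≠ 0`. -/
def VFHomogeneous {n : ℕ} (w : Fin n → ℕ) (Z : Rn n → Rn n) (d : ℤ) : Prop :=
  ∀ t : ℝ, t ≠ 0 → ∀ x : Rn n, VectorField.pullback ℝ (dilation w t) Z x = t ^ d • Z x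

/-- `Z_t = O(t)` in `𝒳(U) ≃ C^∞(U, ℝⁿ)` as `t → 0`, `t ≠ 0`: for each compact `K ⊆ U`, each
multi-order `α` and each component `k`, one has `sup_K |∂^α (Z_t)_k| = O(t)`. -/
def IsBigOtInVF {n : ℕ} (U : Set (Rn n)) (Z : ℝ → Rn n → Rn n) : Prop :=
  ∀ K : Set (Rn n), IsCompact K → K ⊆ U → ∀ (α : Fin n → ℕ) (k : Fin n),
    ∃ C : ℝ, ∀ᶠ t in 𝓝[≠] (0 : ℝ), ∀ x ∈ K, |partialDeriv α (fun y => Z t y k) x| ≤ C * |t|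

/-- On `U` one has `t^{d} δ_t^* Y = Z + O(t)` in the `C^∞` topology of vector fields on `U`,
for some smooth vector field `Z` on `ℝⁿ` that is homogeneous of degree `-d`. -/
def HasHomogeneousModel {n : ℕ} (w : Fin n → ℕ) (U : Set (Rn n)) (Y : Rn n → Rn n) (d : ℕ) :
    Prop :=
  ∃ Z : Rn n → Rn n, ContDiff ℝ ∞ Z ∧ VFHomogeneous w Z (-(d : ℤ)) ∧
    IsBigOtInVF U fun t x => t ^ d • VectorField.pullback ℝ (dilation w t) Y x - Z x

/-! ### Carnot manifolds -/

section Manifold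

variable {n : ℕ} {M : Type*} [TopologicalSpace M] [ChartedSpace (Rn n) M]
  [IsManifold (𝓡 n) ∞ M]

/-- `X` is a smooth vector field over `V`. -/
def SmoothVFOn (X : (x : M) → TangentSpace (𝓡 n) x) (V : Set M) : Prop :=
  ContMDiffOn (𝓡 n) (𝓡 n).tangent ∞ (fun x => (⟨x, X x⟩ : TangentBundle (𝓡 n) M)) V

/-- `H` is a smooth rank `d` subbundle of `TM`: near every point it is spanned by a smooth frame
of `d` pointwise linearly independent vector fields. -/
def IsSmoothSubbundle
    (H : (x : M) → Submodule ℝ (TangentSpace (𝓡 n) x)) (d : ℕ) : Prop :=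
  ∀ x : M, ∃ W : Set M, IsOpen W ∧ x ∈ W ∧
    ∃ Y : Fin d → (x : M) → TangentSpace (𝓡 n) x, (∀ i, SmoothVFOn (Y i) W) ∧
      ∀ y ∈ W, LinearIndependent ℝ (fun i => Y i y) ∧
        Submodule.span ℝ (Set.range fun i => Y i y) = H y

variable (n M) in
/-- A Carnot manifold structure on the `n`-manifold `M`: a filtration
`H 1 ⊆ ⋯ ⊆ H step = TM` by subbundles such that `[H v, H v'] ⊆ H (v + v')` for `v + v' ≤ step`.
Only the indices `1, …, step` are meaningful. -/
structure CarnotStructure where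
  step : ℕ
  one_le_step : 1 ≤ step
  H : ℕ → (x : M) → Submodule ℝ (TangentSpace (𝓡 n) x)
  rank : ℕ → ℕ
  isSubbundle : ∀ v, 1 ≤ v → v ≤ step → IsSmoothSubbundle (H v) (rank v)
  mono : ∀ v, 1 ≤ v → v + 1 ≤ step → ∀ x, H v x ≤ H (v + 1) x
  top : ∀ x, H step x = ⊤
  bracket : ∀ v v', 1 ≤ v → 1 ≤ v' → v + v' ≤ step →
    ∀ Y Z : (x : M) → TangentSpace (𝓡 n) x,
      SmoothVFOn Y Set.univ → SmoothVFOn Z Set.univ →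
      (∀ x, Y x ∈ H v x) → (∀ x, Z x ∈ H v' x) →
      ∀ x, VectorField.mlieBracket (𝓡 n) Y Z x ∈ H (v + v') x

/-- The weight sequence `w_j = min {v ∈ {1, …, r} ; j ≤ rk H_v}`
(the index `j : Fin n` stands for the `(j + 1)`-st entry). -/
def CarnotStructure.weight (C : CarnotStructure n M) (j : Fin n) : ℕ :=
  sInf {v : ℕ | 1 ≤ v ∧ v ≤ C.step ∧ (j : ℕ) + 1 ≤ C.rank v}

/-- `(X₁, …, Xₙ)` is an `H`-frame over `V`: a smooth tangent frame over `V` such that `X_j` is a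
section of `H_{w_j}`. -/
structure IsHFrameOn (C : CarnotStructure n M)
    (X : Fin n → (x : M) → TangentSpace (𝓡 n) x) (V : Set M) : Prop where
  smooth : ∀ j, SmoothVFOn (X j) V
  linearIndependent : ∀ x ∈ V, LinearIndependent ℝ fun j => X j x
  mem : ∀ j, ∀ x ∈ V, X j x ∈ C.H (C.weight j) x

/-! ### Order of functions and privileged coordinates -/

/-- A vector field on `M` acting on functions: `(X f)(x) = df(x)(X(x))`. -/
def mvfOp (X : (x : M) → TangentSpace (𝓡 n) x) (f : M → ℝ) : M → ℝ :=
  fun x => mfderiv (𝓡 n) 𝓘(ℝ, ℝ) f x (X x)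

/-- `X_I f = X_{i₁} ⋯ X_{i_k} f` for a finite sequence `I = (i₁, …, i_k)`. -/
def seqOp (X : Fin n → (x : M) → TangentSpace (𝓡 n) x) (I : List (Fin n)) (f : M → ℝ) : M → ℝ :=
  I.foldr (fun i g => mvfOp (X i) g) f

/-- `⟨I⟩ = w_{i₁} + ⋯ + w_{i_k}`. -/
def seqWeight (w : Fin n → ℕ) (I : List (Fin n)) : ℕ := (I.map w).sum

/-- The function `f`, smooth near `a`, has order `N` at `a` with respect to the frame `X`. -/
def HasOrder (w : Fin n → ℕ) (X : Fin n → (x : M) → TangentSpace (𝓡 n) x) (a : M)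
    (f : M → ℝ) (N : ℕ) : Prop :=
  (∀ I : List (Fin n), seqWeight w I < N → seqOp X I f a = 0) ∧
    ∃ I : List (Fin n), seqWeight w I = N ∧ seqOp X I f a ≠ 0

/-- `φ` is a system of smooth local coordinates of `M` centered at `a`; its domain is `φ.source`
and its range is `φ.target`. -/
structure IsCenteredChart (φ : OpenPartialHomeomorph M (Rn n)) (a : M) : Prop where
  mem_maximalAtlas : φ ∈ IsManifold.maximalAtlas (𝓡 n) ∞ M
  mem_source : a ∈ φ.source
  map_eq_zero : φ a = 0

/-- The vector field `X` on `φ.source`, seen as a vector field on `φ.target ⊆ ℝⁿ`. -/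
def coordVF (φ : OpenPartialHomeomorph M (Rn n)) (X : (x : M) → TangentSpace (𝓡 n) x) :
    Rn n → Rn n :=
  fun u => mfderiv (𝓡 n) (𝓡 n) φ (φ.symm u) (X (φ.symm u))

/-- The coordinates `φ` centered at `a` are linearly adapted at `a` to `X`: in these coordinates
`X_j(0) = ∂_j`. -/
def LinearlyAdapted (φ : OpenPartialHomeomorph M (Rn n))
    (X : Fin n → (x : M) → TangentSpace (𝓡 n) x) : Prop :=
  ∀ j, coordVF φ (X j) 0 = EuclideanSpace.single j (1 : ℝ)

/-- Privileged coordinates (in the sense of Bellaïche and Stefani) at `a` adapted to the `H`-frame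
`X`: linearly adapted coordinates such that each coordinate function `x_k` has order `w_k`. -/
def IsPrivileged (w : Fin n → ℕ) (φ : OpenPartialHomeomorph M (Rn n)) (a : M)
    (X : Fin n → (x : M) → TangentSpace (𝓡 n) x) : Prop :=
  LinearlyAdapted φ X ∧ ∀ k, HasOrder w X a (fun p => φ p k) (w k)

/-- Privileged coordinates in the sense of Goodman: linearly adapted coordinates such that
`t^{w_j} δ_t^* X_j = X_j^{(a)} + O(t)` with `X_j^{(a)}` homogeneous of degree `-w_j`. -/
def IsGoodmanPrivileged (w : Fin n → ℕ) (φ : OpenPartialHomeomorph M (Rn n))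
    (X : Fin n → (x : M) → TangentSpace (𝓡 n) x) : Prop :=
  LinearlyAdapted φ X ∧ ∀ j, HasHomogeneousModel w φ.target (coordVF φ (X j)) (w j)

end Manifold

end Carnot

end

/-! Write `Y j` for the field `X j` in the coordinates. Every condition is compared with one
statement about Taylor coefficients, `ComponentsVanish`: the `k`-th component of `Y j` has weight at
least `w k - w j`.

Operators: under this bound, `Y j` lowers weights by at most `w j`, so composing fields controls all
coefficients of a monomial (`exists_coeff_listOp`). Exactness comes from `Y j 0 = ∂_j`, which makes
one coefficient equal to 1 at the origin. Conversely, applying `Y j` to the coordinate `x_k`, of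
weight `w k`, returns the `k`-th component.

Homogeneous models: pulling back by `δ_t` and multiplying by `t^(w j)` multiplies the rescaled
`k`-th component by `t^(w j - w k)`. The limit exists, with error `O(t)` in all derivatives, exactly
when no Taylor term of weight below `w k - w j` occurs; it is then the Taylor part of that degree
(`exists_taylor_bound`).

Privileged coordinates: `Y k x_k = 1` at the origin, so only the lower bound on the order of `x_k`
matters. It follows from the component bound by counting weights. The converse,
`OrderGE.vanishesTo`, is the delicate point: if each `x_k` has order at least `w k`, then order
bounds imply weight bounds. Apply this to the component `Y j x_k`, whose order is at least `w k - w
j`. The proof replaces `∂_j` by `Y j` plus an error with coefficients vanishing at the origin, by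
induction on weight and then on the number of derivatives. -/

noncomputable section

namespace Carnot

/-! ### Iterated operators along lists of indices, and their relation to multi-indices -/

section Operators

variable {n : ℕ}

/-- The composition `D_{i₁} ∘ ⋯ ∘ D_{i_k}` of a family of operators along a list of indices. -/
def listOp {F : Type*} (D : Fin n → F → F) (I : List (Fin n)) (f : F) : F :=
  I.foldr (fun i g => D i g) f

@[simp] theorem listOp_nil {F : Type*} (D : Fin n → F → F) (f : F) : listOp D [] f = f := rfl

@[simp] theorem listOp_cons {F : Type*} (D : Fin n → F → F) (i : Fin n) (I : List (Fin n))
    (f : F) : listOp D (i :: I) f = D i (listOp D I f) := rfl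

theorem listOp_append {F : Type*} (D : Fin n → F → F) (I J : List (Fin n)) (f : F) :
    listOp D (I ++ J) f = listOp D I (listOp D J f) := by
  simp [listOp, List.foldr_append]

/-- The sorted list in which each index `i` occurs `α i` times. -/
def expand (α : Fin n → ℕ) : List (Fin n) :=
  (List.ofFn fun i => List.replicate (α i) i).flatten

theorem listOp_replicate {F : Type*} (D : Fin n → F → F) (i : Fin n) (m : ℕ) (f : F) :
    listOp D (List.replicate m i) f = (D i)^[m] f := by
  induction m with
  | zero => rfl
  | succ m ih => rw [List.replicate_succ, listOp_cons, ih, Function.iterate_succ_apply']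

theorem monomial_eq_listOp {F : Type*} (D : Fin n → F → F) (α : Fin n → ℕ) (f : F) :
    monomial D α f = listOp D (expand α) f := by
  have key : ∀ L : List (Fin n),
      ((L.map fun i => (D i)^[α i]).foldr (fun S T => S ∘ T) id) f =
        listOp D (L.map fun i => List.replicate (α i) i).flatten f := by
    intro L
    induction L with
    | nil => rfl
    | cons i L ih =>
      simp only [List.map_cons, List.foldr_cons, Function.comp_apply, List.flatten_cons,
        listOp_append, listOp_replicate]
      rw [ih]
  rw [monomial, expand, List.ofFn_eq_map, List.ofFn_eq_map]
  exact key _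

theorem count_expand (α : Fin n → ℕ) (i : Fin n) : (expand α).count i = α i := by
  rw [expand, List.count_flatten, List.map_ofFn, List.sum_ofFn]
  simp [List.count_replicate]

theorem sum_map_expand {Γ : Type*} [AddCommMonoid Γ] (v : Fin n → Γ) (α : Fin n → ℕ) :
    ((expand α).map v).sum = ∑ i, α i • v i := by
  rw [expand, List.map_flatten, List.sum_flatten, List.map_ofFn, List.map_ofFn, List.sum_ofFn]
  simp

theorem length_expand (α : Fin n → ℕ) : (expand α).length = ∑ i, α i := by
  rw [expand, List.length_flatten, List.map_ofFn, List.sum_ofFn]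
  simp

theorem expand_count_perm (I : List (Fin n)) : (expand fun i => I.count i).Perm I := by
  rw [List.perm_iff_count]
  intro i
  rw [count_expand]

theorem wlen_eq_sum (w : Fin n → ℕ) (α : Fin n → ℕ) :
    (wlen w α : ℤ) = ((expand α).map fun i => (w i : ℤ)).sum := by
  rw [sum_map_expand, wlen]
  push_cast
  exact Finset.sum_congr rfl fun i _ => by simp [mul_comm]

/-! ### Partial derivatives of smooth functions on an open set -/

/-- The partial derivative `∂_i`. -/
def pd (i : Fin n) : (Rn n → ℝ) → Rn n → ℝ := vfOp fun _ => EuclideanSpace.single i (1 : ℝ)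

theorem partialDeriv_eq_listOp (α : Fin n → ℕ) (f : Rn n → ℝ) :
    partialDeriv α f = listOp pd (expand α) f :=
  monomial_eq_listOp _ _ _

variable {U : Set (Rn n)}

theorem eq_sum_single (y : Rn n) : y = ∑ k, y k • EuclideanSpace.single k (1 : ℝ) := by
  ext i
  simp [Pi.single_apply]

theorem vfOp_eq_sum (Y : Rn n → Rn n) (f : Rn n → ℝ) (x : Rn n) :
    vfOp Y f x = ∑ k, Y x k * pd k f x := by
  simp only [vfOp, pd]
  conv_lhs => rw [eq_sum_single (Y x)]
  simp

theorem SmoothOn.differentiableAt (hU : IsOpen U) {F : Type*} [NormedAddCommGroup F]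
    [NormedSpace ℝ F] {f : Rn n → F} (hf : ContDiffOn ℝ ∞ f U) {x : Rn n} (hx : x ∈ U) :
    DifferentiableAt ℝ f x :=
  (hf.contDiffAt (hU.mem_nhds hx)).differentiableAt (by simp)

theorem contDiffOn_vfOp (hU : IsOpen U) {Y : Rn n → Rn n} (hY : ContDiffOn ℝ ∞ Y U)
    {f : Rn n → ℝ} (hf : ContDiffOn ℝ ∞ f U) : ContDiffOn ℝ ∞ (vfOp Y f) U :=
  (hf.fderiv_of_isOpen hU (m := ∞) (by simp)).clm_apply hY

theorem contDiffOn_pd (hU : IsOpen U) {f : Rn n → ℝ} (hf : ContDiffOn ℝ ∞ f U) (i : Fin n) :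
    ContDiffOn ℝ ∞ (pd i f) U :=
  contDiffOn_vfOp hU contDiffOn_const hf

theorem contDiffOn_listOp {D : Fin n → (Rn n → ℝ) → Rn n → ℝ}
    (hD : ∀ i f, ContDiffOn ℝ ∞ f U → ContDiffOn ℝ ∞ (D i f) U) {f : Rn n → ℝ}
    (hf : ContDiffOn ℝ ∞ f U) (I : List (Fin n)) : ContDiffOn ℝ ∞ (listOp D I f) U := by
  induction I with
  | nil => exact hf
  | cons i I ih => exact hD i _ ih

theorem contDiffOn_listOp_pd (hU : IsOpen U) {f : Rn n → ℝ} (hf : ContDiffOn ℝ ∞ f U)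
    (I : List (Fin n)) : ContDiffOn ℝ ∞ (listOp pd I f) U :=
  contDiffOn_listOp (fun i _ h => contDiffOn_pd hU h i) hf I

theorem vfOp_congr (hU : IsOpen U) {f g : Rn n → ℝ} (h : Set.EqOn f g U) (Y : Rn n → Rn n) :
    Set.EqOn (vfOp Y f) (vfOp Y g) U := fun x hx => by
  simp only [vfOp, (h.eventuallyEq_of_mem (hU.mem_nhds hx)).fderiv_eq]

theorem listOp_vfOp_congr (hU : IsOpen U) {f g : Rn n → ℝ} (h : Set.EqOn f g U)
    (Y : Fin n → Rn n → Rn n) (I : List (Fin n)) :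
    Set.EqOn (listOp (fun i => vfOp (Y i)) I f) (listOp (fun i => vfOp (Y i)) I g) U := by
  induction I with
  | nil => exact h
  | cons i I ih => exact vfOp_congr hU ih _

theorem listOp_pd_congr (hU : IsOpen U) {f g : Rn n → ℝ} (h : Set.EqOn f g U)
    (I : List (Fin n)) : Set.EqOn (listOp pd I f) (listOp pd I g) U :=
  listOp_vfOp_congr hU h _ I

theorem pd_comm (hU : IsOpen U) {f : Rn n → ℝ} (hf : ContDiffOn ℝ ∞ f U) (i j : Fin n) :
    Set.EqOn (pd i (pd j f)) (pd j (pd i f)) U := by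
  intro x hx
  have hd : DifferentiableAt ℝ (fderiv ℝ f) x :=
    SmoothOn.differentiableAt hU (hf.fderiv_of_isOpen hU (m := ∞) (by simp)) hx
  have hs := (hf.contDiffAt (hU.mem_nhds hx)).isSymmSndFDerivAt
    (by simpa using WithTop.coe_le_coe.2 (le_top : (2 : ℕ∞) ≤ ⊤))
  have key : ∀ k l : Fin n, pd k (pd l f) x =
      fderiv ℝ (fderiv ℝ f) x (EuclideanSpace.single k 1) (EuclideanSpace.single l 1) := by
    intro k l
    change fderiv ℝ (fun y => fderiv ℝ f y (EuclideanSpace.single l 1)) x _ = _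
    rw [fderiv_clm_apply hd (differentiableAt_const _)]
    simp
  rw [key, key, hs.eq]

/-- Symmetry of second derivatives makes lists interchangeable with multi-indices. Lists are kept
because they suit induction and also describe the non-commuting frame fields. -/
theorem listOp_pd_perm (hU : IsOpen U) {I J : List (Fin n)} (h : I.Perm J) {f : Rn n → ℝ}
    (hf : ContDiffOn ℝ ∞ f U) : Set.EqOn (listOp pd I f) (listOp pd J f) U := by
  induction h with
  | nil => exact fun _ _ => rfl
  | cons i _ ih => exact vfOp_congr hU ih _
  | swap i j I => exact pd_comm hU (contDiffOn_listOp_pd hU hf I) _ _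
  | trans _ _ ih₁ ih₂ => exact ih₁.trans ih₂

theorem pd_add (hU : IsOpen U) {f g : Rn n → ℝ} (hf : ContDiffOn ℝ ∞ f U)
    (hg : ContDiffOn ℝ ∞ g U) (i : Fin n) :
    Set.EqOn (pd i (fun x => f x + g x)) (fun x => pd i f x + pd i g x) U := by
  intro x hx
  simp only [pd, vfOp]
  rw [fderiv_fun_add (SmoothOn.differentiableAt hU hf hx) (SmoothOn.differentiableAt hU hg hx)]
  rfl

theorem pd_mul (hU : IsOpen U) {f g : Rn n → ℝ} (hf : ContDiffOn ℝ ∞ f U)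
    (hg : ContDiffOn ℝ ∞ g U) (i : Fin n) :
    Set.EqOn (pd i (fun x => f x * g x)) (fun x => pd i f x * g x + f x * pd i g x) U := by
  intro x hx
  simp only [pd, vfOp]
  rw [fderiv_fun_mul (SmoothOn.differentiableAt hU hf hx) (SmoothOn.differentiableAt hU hg hx)]
  simp [mul_comm, add_comm]

theorem listOp_pd_add (hU : IsOpen U) {f g : Rn n → ℝ} (hf : ContDiffOn ℝ ∞ f U)
    (hg : ContDiffOn ℝ ∞ g U) (I : List (Fin n)) :
    Set.EqOn (listOp pd I (fun x => f x + g x))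
      (fun x => listOp pd I f x + listOp pd I g x) U := by
  induction I with
  | nil => exact fun _ _ => rfl
  | cons i I ih =>
    exact (vfOp_congr hU ih _).trans
      (pd_add hU (contDiffOn_listOp_pd hU hf I) (contDiffOn_listOp_pd hU hg I) i)

theorem pd_const (c : ℝ) (i : Fin n) : pd i (fun _ => c) = fun _ => 0 := by
  funext x
  simp [pd, vfOp]

theorem pd_coord (i k : Fin n) :
    pd i (fun x : Rn n => x k) = fun _ => if i = k then 1 else 0 := by
  funext x
  have : HasFDerivAt (fun x : Rn n => x k) (EuclideanSpace.proj k : Rn n →L[ℝ] ℝ) x :=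
    (EuclideanSpace.proj k : Rn n →L[ℝ] ℝ).hasFDerivAt
  simp [pd, vfOp, this.fderiv, eq_comm]

theorem contDiff_coord (k : Fin n) : ContDiff ℝ ∞ (fun x : Rn n => x k) :=
  (EuclideanSpace.proj k : Rn n →L[ℝ] ℝ).contDiff

theorem contDiffOn_coord {Y : Rn n → Rn n} (hY : ContDiffOn ℝ ∞ Y U) (k : Fin n) :
    ContDiffOn ℝ ∞ (fun x => Y x k) U :=
  (contDiff_coord k).comp_contDiffOn hY

end Operators

/-! ### Vanishing at the origin with respect to a weight -/

section Vanishing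

variable {n : ℕ} {U : Set (Rn n)} {Γ : Type*} [AddCommGroup Γ] [LinearOrder Γ]

/-- All derivatives at `0` of weight less than `N` vanish, where `∂_i` has weight `v i`. -/
def VanishesTo (v : Fin n → Γ) (f : Rn n → ℝ) (N : Γ) : Prop :=
  ∀ I : List (Fin n), (I.map v).sum < N → listOp pd I f 0 = 0

variable {v : Fin n → Γ} {f g : Rn n → ℝ} {N N' : Γ}

theorem VanishesTo.mono (h : VanishesTo v f N) (hN : N' ≤ N) : VanishesTo v f N' :=
  fun I hI => h I (hI.trans_le hN)

theorem VanishesTo.congr (hU : IsOpen U) (h0 : (0 : Rn n) ∈ U) (hfg : Set.EqOn f g U)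
    (h : VanishesTo v f N) : VanishesTo v g N :=
  fun I hI => (listOp_pd_congr hU hfg I h0).symm.trans (h I hI)

theorem vanishesTo_zero : VanishesTo v (fun _ : Rn n => (0 : ℝ)) N := by
  intro I _
  clear * -
  have : listOp Carnot.pd I (fun _ : Rn n => (0 : ℝ)) = fun _ => 0 := by
    induction I with
    | nil => rfl
    | cons i I ih => rw [listOp_cons, ih, pd_const]
  rw [this]

theorem VanishesTo.add (hU : IsOpen U) (h0 : (0 : Rn n) ∈ U) (hf : ContDiffOn ℝ ∞ f U)
    (hg : ContDiffOn ℝ ∞ g U) (hfN : VanishesTo v f N) (hgN : VanishesTo v g N) :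
    VanishesTo v (fun x => f x + g x) N := by
  intro I hI
  simp only [listOp_pd_add hU hf hg I h0, hfN I hI, hgN I hI, add_zero]

theorem VanishesTo.sum (hU : IsOpen U) (h0 : (0 : Rn n) ∈ U) {ι : Type*} (s : Finset ι)
    {F : ι → Rn n → ℝ} (hF : ∀ i ∈ s, ContDiffOn ℝ ∞ (F i) U)
    (hN : ∀ i ∈ s, VanishesTo v (F i) N) : VanishesTo v (fun x => ∑ i ∈ s, F i x) N := by
  classical
  induction s using Finset.induction_on with
  | empty => simpa using vanishesTo_zero
  | insert i s hi ih =>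
    simp only [Finset.sum_insert hi]
    exact VanishesTo.add hU h0 (hF i (by simp))
      (ContDiffOn.sum fun j hj => hF j (by simp [hj])) (hN i (by simp))
      (ih (fun j hj => hF j (by simp [hj])) fun j hj => hN j (by simp [hj]))

variable [IsOrderedAddMonoid Γ]

theorem VanishesTo.of_nonpos (hv : ∀ i, 0 ≤ v i) (hN : N ≤ 0) : VanishesTo v f N := by
  intro I hI
  refine absurd (hI.trans_le hN) (not_lt.2 (List.sum_nonneg ?_))
  simp only [List.mem_map, forall_exists_index, and_imp]
  rintro _ i _ rfl
  exact hv i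

theorem vanishesTo_iff_pd :
    VanishesTo v f N ↔ (0 < N → f 0 = 0) ∧ ∀ i, VanishesTo v (pd i f) (N - v i) := by
  constructor
  · intro h
    refine ⟨fun hN => h [] (by simpa using hN), fun i I hI => ?_⟩
    have := h (I ++ [i]) (by simpa using lt_sub_iff_add_lt.1 hI)
    rwa [listOp_append] at this
  · rintro ⟨h₁, h₂⟩ I hI
    rcases List.eq_nil_or_concat I with rfl | ⟨J, i, rfl⟩
    · exact h₁ (by simpa using hI)
    · rw [List.concat_eq_append, listOp_append]
      refine h₂ i J (lt_sub_iff_add_lt.2 ?_)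
      simpa using hI

theorem VanishesTo.pd (h : VanishesTo v f N) (i : Fin n) :
    VanishesTo v (Carnot.pd i f) (N - v i) := (vanishesTo_iff_pd.1 h).2 i

/-- Leibniz rule, peeling off the innermost derivative: each derivative costs its weight on one
factor only. An arbitrary ordered group of weights lets this serve both integer and lexicographic
weights. -/
theorem VanishesTo.mul (hU : IsOpen U) (h0 : (0 : Rn n) ∈ U) (hf : ContDiffOn ℝ ∞ f U)
    (hg : ContDiffOn ℝ ∞ g U) (hfN : VanishesTo v f N) (hgN : VanishesTo v g N') :
    VanishesTo v (fun x => f x * g x) (N + N') := by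
  intro I
  induction I using List.reverseRecOn generalizing f g N N' with
  | nil =>
    intro hI
    simp only [List.map_nil, List.sum_nil] at hI
    have : 0 < N ∨ 0 < N' := by
      by_contra! h
      exact absurd hI (not_lt.2 (add_nonpos h.1 h.2))
    rcases this with h | h
    · simp [(vanishesTo_iff_pd.1 hfN).1 h]
    · simp [(vanishesTo_iff_pd.1 hgN).1 h]
  | append_singleton I i ih =>
    intro hI
    simp only [List.map_append, List.map_cons, List.map_nil, List.sum_append, List.sum_cons,
      List.sum_nil, add_zero] at hI
    have hI' := lt_sub_iff_add_lt.2 hI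
    rw [listOp_append, listOp_cons, listOp_nil, listOp_pd_congr hU (pd_mul hU hf hg i) I h0]
    refine (listOp_pd_add hU ((contDiffOn_pd hU hf i).mul hg)
      (hf.mul (contDiffOn_pd hU hg i)) I h0).trans ?_
    beta_reduce
    rw [ih (contDiffOn_pd hU hf i) hg (hfN.pd i) hgN (hI'.trans_eq (by abel)),
      ih hf (contDiffOn_pd hU hg i) hfN (hgN.pd i) (hI'.trans_eq (by abel)), add_zero]

theorem VanishesTo.listOp_pd (h : VanishesTo v f N) (I : List (Fin n)) :
    VanishesTo v (listOp Carnot.pd I f) (N - (I.map v).sum) := by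
  intro J hJ
  rw [← listOp_append]
  exact h _ (by simpa using lt_sub_iff_add_lt.1 hJ)

end Vanishing

/-! ### Comparison of multi-index weights with vanishing along lists -/

section Weight

variable {n : ℕ} {U : Set (Rn n)} {w : Fin n → ℕ} {f : Rn n → ℝ}

theorem weightGE_iff (hU : IsOpen U) (h0 : (0 : Rn n) ∈ U) (hf : ContDiffOn ℝ ∞ f U) (N : ℤ) :
    WeightGE w f N ↔ VanishesTo (fun i => (w i : ℤ)) f N := by
  constructor
  · intro h I hI
    rw [← listOp_pd_perm hU (expand_count_perm I) hf h0, ← partialDeriv_eq_listOp]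
    apply h
    rwa [wlen_eq_sum, ((expand_count_perm I).map _).sum_eq]
  · intro h α hα
    rw [partialDeriv_eq_listOp]
    exact h _ (by rwa [← wlen_eq_sum])

end Weight

/-! ### Order along the frame versus weight in the coordinates -/

section Order

variable {n : ℕ} {U : Set (Rn n)} {w : Fin n → ℕ} {Y : Fin n → Rn n → Rn n}
  {f : Rn n → ℝ} {N : ℤ}

/-- The weights `w` regarded as integers. -/
abbrev intWeight (w : Fin n → ℕ) (i : Fin n) : ℤ := w i

/-- The bigraded weights `(w i, 1)`, ordered lexicographically. -/
def lexWeight (w : Fin n → ℕ) (i : Fin n) : ℤ ×ₗ ℤ := toLex ((w i : ℤ), 1)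

theorem sum_map_lexWeight (w : Fin n → ℕ) (I : List (Fin n)) :
    (I.map (lexWeight w)).sum = toLex ((I.map (intWeight w)).sum, (I.length : ℤ)) := by
  induction I with
  | nil => rfl
  | cons i I ih =>
    rw [List.map_cons, List.sum_cons, ih, List.map_cons, List.sum_cons, lexWeight, ← toLex_add,
      Prod.mk_add_mk, List.length_cons]
    push_cast
    rw [add_comm (1 : ℤ)]

/-- The only list of length less than 1 is empty, so vanishing at the origin gains one unit in the
second grading. This gain drives the induction on length below. -/
theorem vanishesTo_lexWeight_one (h : VanishesTo (intWeight w) f N) (hf : f 0 = 0) :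
    VanishesTo (lexWeight w) f (toLex (N, 1)) := by
  intro I hI
  rw [sum_map_lexWeight, Prod.Lex.toLex_lt_toLex] at hI
  rcases hI with hI | ⟨-, hI⟩
  · exact h I hI
  · have : I = [] := List.length_eq_zero_iff.1 (by simp only at hI; omega)
    simpa [this] using hf

theorem vanishesTo_lexWeight_zero (h : VanishesTo (intWeight w) f N) :
    VanishesTo (lexWeight w) f (toLex (N, 0)) := by
  intro I hI
  rw [sum_map_lexWeight, Prod.Lex.toLex_lt_toLex] at hI
  rcases hI with hI | ⟨-, hI⟩
  · exact h I hI
  · simp only at hI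
    omega

/-- All iterated derivatives of `f` along the fields `Y i` of weight less than `N` vanish at `0`. -/
def OrderGE (w : Fin n → ℕ) (Y : Fin n → Rn n → Rn n) (f : Rn n → ℝ) (N : ℤ) : Prop :=
  ∀ I : List (Fin n), (I.map (intWeight w)).sum < N → listOp (fun i => vfOp (Y i)) I f 0 = 0

theorem OrderGE.mono {N' : ℤ} (h : OrderGE w Y f N) (hN : N' ≤ N) : OrderGE w Y f N' :=
  fun I hI => h I (hI.trans_le hN)

theorem OrderGE.vfOp (h : OrderGE w Y f N) (j : Fin n) :
    OrderGE w Y (Carnot.vfOp (Y j) f) (N - w j) := by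
  intro I hI
  have := h (I ++ [j]) (by simpa using lt_sub_iff_add_lt.1 hI)
  rwa [listOp_append] at this

theorem vfOp_coord (Z : Rn n → Rn n) (k : Fin n) :
    Carnot.vfOp Z (fun x => x k) = fun x => Z x k := by
  funext x
  rw [vfOp_eq_sum]
  simp [pd_coord]

theorem vanishesTo_coord (k : Fin n) :
    VanishesTo (intWeight w) (fun x : Rn n => x k) (w k) := by
  rw [vanishesTo_iff_pd]
  refine ⟨fun _ => rfl, fun i => ?_⟩
  rw [pd_coord]
  by_cases h : i = k
  · subst h
    exact VanishesTo.of_nonpos (fun _ => by simp) (by simp)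
  · simpa [h] using vanishesTo_zero

/-- The components of `Y j` have weight at least `w k - w j`. -/
def ComponentsVanish (w : Fin n → ℕ) (Y : Fin n → Rn n → Rn n) : Prop :=
  ∀ j k, VanishesTo (intWeight w) (fun x => Y j x k) ((w k : ℤ) - w j)

theorem VanishesTo.vfOp (hU : IsOpen U) (h0 : (0 : Rn n) ∈ U)
    (hY : ∀ j, ContDiffOn ℝ ∞ (Y j) U) (hYw : ComponentsVanish w Y)
    (hf : ContDiffOn ℝ ∞ f U) (h : VanishesTo (intWeight w) f N) (j : Fin n) :
    VanishesTo (intWeight w) (Carnot.vfOp (Y j) f) (N - w j) := by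
  have hs : Carnot.vfOp (Y j) f = fun x => ∑ k, Y j x k * Carnot.pd k f x :=
    funext fun x => vfOp_eq_sum _ _ _
  rw [hs]
  refine VanishesTo.sum hU h0 _
    (fun k _ => (contDiffOn_coord (hY j) k).mul (contDiffOn_pd hU hf k)) fun k _ => ?_
  refine (VanishesTo.mul hU h0 (contDiffOn_coord (hY j) k) (contDiffOn_pd hU hf k)
    (hYw j k) (h.pd k)).mono (le_of_eq ?_)
  simp only [intWeight]
  ring

theorem contDiffOn_listOp_vfOp (hU : IsOpen U) (hY : ∀ j, ContDiffOn ℝ ∞ (Y j) U)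
    (hf : ContDiffOn ℝ ∞ f U) (I : List (Fin n)) :
    ContDiffOn ℝ ∞ (listOp (fun i => Carnot.vfOp (Y i)) I f) U :=
  contDiffOn_listOp (fun i _ h => contDiffOn_vfOp hU (hY i) h) hf I

/-- Each field lowers weight by at most its own weight, so after fewer than `N` units the result
still has positive weight and vanishes at the origin. -/
theorem VanishesTo.orderGE (hU : IsOpen U) (h0 : (0 : Rn n) ∈ U)
    (hY : ∀ j, ContDiffOn ℝ ∞ (Y j) U) (hYw : ComponentsVanish w Y)
    (hf : ContDiffOn ℝ ∞ f U) (h : VanishesTo (intWeight w) f N) : OrderGE w Y f N := by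
  have key : ∀ I : List (Fin n), VanishesTo (intWeight w)
      (listOp (fun i => Carnot.vfOp (Y i)) I f) (N - (I.map (intWeight w)).sum) := by
    intro I
    induction I with
    | nil => simpa using h
    | cons i I ih =>
      refine (ih.vfOp hU h0 hY hYw (contDiffOn_listOp_vfOp hU hY hf I) i).mono (le_of_eq ?_)
      simp only [List.map_cons, List.sum_cons]
      ring
  exact fun I hI => (vanishesTo_iff_pd.1 (key I)).1 (sub_pos.2 hI)

/-- Double induction. The outer one, on the weight and over all functions, also applies to the
components of the fields, since these are derivatives `Y j x_k`. The inner one, on the number of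
derivatives, treats those of top weight. -/
theorem OrderGE.vanishesTo (hU : IsOpen U) (h0 : (0 : Rn n) ∈ U)
    (hY : ∀ j, ContDiffOn ℝ ∞ (Y j) U) (hY0 : ∀ j, Y j 0 = EuclideanSpace.single j (1 : ℝ))
    (hw : ∀ j, 1 ≤ w j) (hx : ∀ k, OrderGE w Y (fun x => x k) (w k))
    (hf : ContDiffOn ℝ ∞ f U) (h : OrderGE w Y f N) : VanishesTo (intWeight w) f N := by
  have key : ∀ m : ℕ, ∀ z : ℤ, z ≤ m → ∀ g : Rn n → ℝ, ContDiffOn ℝ ∞ g U → OrderGE w Y g z →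
      VanishesTo (intWeight w) g z := by
    intro m
    induction m with
    | zero => exact fun z hz g _ _ => VanishesTo.of_nonpos (fun _ => by simp) (by simpa using hz)
    | succ m ih =>
      intro z hz g hg hgz
      rcases lt_or_eq_of_le hz with hz | rfl
      · exact ih z (by push_cast at hz; omega) g hg hgz
      push_cast at hgz ⊢
      -- Weights below `m` are already settled, so only derivatives of weight exactly `m` remain;
      -- they are handled by increasing length.
      have hlex : ∀ p : ℕ, VanishesTo (lexWeight w) g (toLex ((m : ℤ), (p : ℤ))) := by
        intro p
        induction p with
        | zero =>
          exact vanishesTo_lexWeight_zero (ih m le_rfl g hg (hgz.mono (by omega)))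
        | succ p ihp =>
          rw [vanishesTo_iff_pd]
          refine ⟨fun _ => by simpa using hgz [] (by simp), fun j => ?_⟩
          have hN : toLex ((m : ℤ), ((p + 1 : ℕ) : ℤ)) - lexWeight w j =
              toLex ((m : ℤ) - w j, (p : ℤ)) := by
            rw [lexWeight, ← toLex_sub, Prod.mk_sub_mk]
            simp
          rw [hN]
          -- Coefficients of `∂_j - Y j`, which vanish at the origin by linear adaptation.
          let c : Fin n → Rn n → ℝ := fun k x => (if k = j then 1 else 0) - Y j x k
          have hc : ∀ k, ContDiffOn ℝ ∞ (c k) U := fun k =>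
            contDiffOn_const.sub (contDiffOn_coord (hY j) k)
          have hsum : Set.EqOn (fun x => Carnot.vfOp (Y j) g x + ∑ k, c k x * Carnot.pd k g x)
              (Carnot.pd j g) U := by
            intro x _
            simp only [vfOp_eq_sum (Y j), c, sub_mul, Finset.sum_sub_distrib, ite_mul, one_mul,
              zero_mul, Finset.sum_ite_eq', Finset.mem_univ, if_true]
            ring
          refine VanishesTo.congr hU h0 hsum (VanishesTo.add hU h0 (contDiffOn_vfOp hU (hY j) hg)
            (ContDiffOn.sum fun k _ => (hc k).mul (contDiffOn_pd hU hg k)) ?_ ?_)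
          -- Since `w j ≥ 1`, the order `m + 1 - w j` of `Y j g` is within reach of the outer
          -- induction. The resulting weight strictly exceeds `m - w j`, so the length plays no
          -- role.
          · have hwj := hw j
            refine (vanishesTo_lexWeight_zero (ih _ ?_ _ (contDiffOn_vfOp hU (hY j) hg)
              (hgz.vfOp j))).mono ?_
            · omega
            · rw [Prod.Lex.toLex_le_toLex]
              left
              simp only
              omega
          · refine VanishesTo.sum hU h0 _ (fun k _ => (hc k).mul (contDiffOn_pd hU hg k))
              fun k _ => ?_
            -- The bound is cut off at `m` because the outer hypothesis reaches no further.
            have hck : VanishesTo (lexWeight w) (c k) (toLex (min ((w k : ℤ) - w j) m, 1)) := by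
              refine vanishesTo_lexWeight_one ?_ ?_
              · by_cases hkj : k = j
                · subst hkj
                  exact VanishesTo.of_nonpos (fun _ => by simp) (by simp)
                · have hck' : c k = fun x => (-1) * Y j x k := by
                    funext x
                    simp [c, hkj]
                  rw [hck']
                  have hYv : VanishesTo (intWeight w) (fun x => Y j x k)
                      (min ((w k : ℤ) - w j) m) := by
                    refine ih _ (min_le_right _ _) _ (contDiffOn_coord (hY j) k) ?_
                    rw [← vfOp_coord]
                    exact ((hx k).vfOp j).mono (min_le_left _ _)
                  exact (VanishesTo.mul hU h0 contDiffOn_const (contDiffOn_coord (hY j) k)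
                    (VanishesTo.of_nonpos (fun _ => by simp) le_rfl) hYv).mono (by simp)
              · simp [c, hY0]
            have hwj := hw j
            -- Without cutoff, `(w k - w j, 1) + (m - w k, p - 1)` is exactly `(m - w j, p)`. With
            -- cutoff, the weight `m` alone already exceeds `m - w j`.
            rcases min_choice ((w k : ℤ) - w j) m with hmin | hmin <;> rw [hmin] at hck
            · refine (VanishesTo.mul hU h0 (hc k) (contDiffOn_pd hU hg k) hck
                (ihp.pd k)).mono (le_of_eq ?_)
              rw [lexWeight, ← toLex_sub, ← toLex_add, Prod.mk_sub_mk, Prod.mk_add_mk]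
              congr 2 <;> ring
            · refine (VanishesTo.mul hU h0 (hc k) (contDiffOn_pd hU hg k) hck
                (vanishesTo_lexWeight_zero (N := 0)
                  (VanishesTo.of_nonpos (fun _ => by simp) le_rfl))).mono ?_
              rw [← toLex_add, Prod.mk_add_mk, Prod.Lex.toLex_le_toLex]
              left
              simp only
              omega
      intro I hI
      refine hlex (I.length + 1) I ?_
      rw [sum_map_lexWeight, Prod.Lex.toLex_lt_toLex]
      simp only
      push_cast
      omega
  exact key N.toNat N (Int.self_le_toNat N) f hf h

theorem componentsVanish_iff_orderGE (hU : IsOpen U) (h0 : (0 : Rn n) ∈ U)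
    (hY : ∀ j, ContDiffOn ℝ ∞ (Y j) U) (hY0 : ∀ j, Y j 0 = EuclideanSpace.single j (1 : ℝ))
    (hw : ∀ j, 1 ≤ w j) :
    ComponentsVanish w Y ↔ ∀ k, OrderGE w Y (fun x => x k) (w k) := by
  constructor
  · exact fun h k => (vanishesTo_coord k).orderGE hU h0 hY h (contDiff_coord k).contDiffOn
  · intro h j k
    refine OrderGE.vanishesTo hU h0 hY hY0 hw h (contDiffOn_coord (hY j) k) ?_
    rw [← vfOp_coord]
    exact (h k).vfOp j

end Order

/-! ### Weights of differential operators and coefficients of compositions -/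

section DiffOp

variable {n : ℕ} {U : Set (Rn n)} {w : Fin n → ℕ} {Y : Fin n → Rn n → Rn n}

theorem expand_single (j : Fin n) : expand (Pi.single j 1) = [j] := by
  refine List.perm_singleton.1 (List.perm_iff_count.2 fun i => ?_)
  rw [count_expand, List.count_singleton]
  by_cases h : j = i
  · subst h; simp
  · simp [h, Ne.symm h]

theorem expand_zero : expand (0 : Fin n → ℕ) = [] := by
  refine List.perm_nil.1 (List.perm_iff_count.2 fun i => ?_)
  rw [count_expand]
  simp

theorem expand_add_single_perm (α : Fin n → ℕ) (j : Fin n) :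
    (expand (α + Pi.single j 1)).Perm (j :: expand α) := by
  refine List.perm_iff_count.2 fun i => ?_
  rw [count_expand, List.count_cons, count_expand, Pi.add_apply, Pi.single_apply]
  by_cases h : i = j
  · subst h; simp
  · simp [h, Ne.symm h]

theorem count_cons_eq (j : Fin n) (I : List (Fin n)) :
    (fun i => (j :: I).count i) = (fun i => I.count i) + Pi.single j 1 := by
  funext i
  rw [Pi.add_apply, List.count_cons, Pi.single_apply]
  by_cases h : i = j
  · subst h; simp
  · simp [h, Ne.symm h]

theorem sum_count (I : List (Fin n)) : ∑ i, I.count i = I.length := by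
  rw [← length_expand, (expand_count_perm I).length_eq]

theorem wlen_add_single (α : Fin n → ℕ) (j : Fin n) :
    wlen w (α + Pi.single j 1) = wlen w α + w j := by
  simp [wlen, mul_add, Finset.sum_add_distrib, Pi.single_apply]

/-- A differential operator of weight `N` raises the weight of functions by at least `N`. -/
theorem DiffOpHasWeight.vanishesTo {P : (Rn n → ℝ) → Rn n → ℝ} {N M : ℤ} (hU : IsOpen U)
    (h0 : (0 : Rn n) ∈ U) (hP : DiffOpHasWeight w U P N) {f : Rn n → ℝ}
    (hf : ContDiffOn ℝ ∞ f U) (h : VanishesTo (intWeight w) f M) :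
    VanishesTo (intWeight w) (P f) (N + M) := by
  obtain ⟨m, a, ⟨ha, hPa⟩, haN, -⟩ := hP
  have hs : Set.EqOn (fun x => ∑ α ∈ multiOrders n m, a α x * listOp pd (expand α) f x)
      (P f) U := fun x hx => by
    simp only [hPa f hf x hx, partialDeriv_eq_listOp]
  refine VanishesTo.congr hU h0 hs (VanishesTo.sum hU h0 _
    (fun α hα => (ha α hα).mul (contDiffOn_listOp_pd hU hf _)) fun α hα => ?_)
  refine (VanishesTo.mul hU h0 (ha α hα) (contDiffOn_listOp_pd hU hf _)
    ((weightGE_iff hU h0 (ha α hα) _).1 (haN α hα)) (h.listOp_pd (expand α))).mono (le_of_eq ?_)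
  rw [wlen_eq_sum]
  ring

theorem ComponentsVanish.of_diffOpHasWeight (hU : IsOpen U) (h0 : (0 : Rn n) ∈ U)
    (h : ∀ j, DiffOpHasWeight w U (vfOp (Y j)) (-(w j : ℤ))) : ComponentsVanish w Y := by
  intro j k
  have := (h j).vanishesTo hU h0 (contDiff_coord k).contDiffOn (vanishesTo_coord (w := w) k)
  rw [vfOp_coord] at this
  exact this.mono (by omega)

/-- The coefficients of the composition of `Z` with the operator with coefficients `a`. -/
def compCoeff (Z : Rn n → Rn n) (a : (Fin n → ℕ) → Rn n → ℝ) (γ : Fin n → ℕ) (x : Rn n) : ℝ :=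
  vfOp Z (a γ) x + ∑ k, if 1 ≤ γ k then Z x k * a (γ - Pi.single k 1) x else 0

theorem sub_single_add_single {γ : Fin n → ℕ} {k : Fin n} (h : 1 ≤ γ k) :
    γ - Pi.single k 1 + Pi.single k 1 = γ := by
  funext i
  by_cases hi : i = k
  · subst hi; simp [h]
  · simp [hi]

theorem sum_add_single (γ : Fin n → ℕ) (k : Fin n) :
    ∑ i, (γ + Pi.single k 1 : Fin n → ℕ) i = ∑ i, γ i + 1 := by
  simp [Finset.sum_add_distrib, Pi.single_apply]

theorem contDiffOn_compCoeff (hU : IsOpen U) {Z : Rn n → Rn n} (hZ : ContDiffOn ℝ ∞ Z U)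
    {a : (Fin n → ℕ) → Rn n → ℝ} (ha : ∀ γ, ContDiffOn ℝ ∞ (a γ) U) (γ : Fin n → ℕ) :
    ContDiffOn ℝ ∞ (compCoeff Z a γ) U := by
  refine (contDiffOn_vfOp hU hZ (ha γ)).add (ContDiffOn.sum fun k _ => ?_)
  by_cases h : 1 ≤ γ k
  · simpa only [h, if_true] using (contDiffOn_coord hZ k).mul (ha _)
  · simpa only [h, if_false] using contDiffOn_const

theorem compCoeff_eq_zero {Z : Rn n → Rn n} {a : (Fin n → ℕ) → Rn n → ℝ} {m : ℕ}
    (ha : ∀ γ : Fin n → ℕ, m < ∑ i, γ i → a γ = fun _ => 0) {γ : Fin n → ℕ}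
    (hγ : m + 1 < ∑ i, γ i) : compCoeff Z a γ = fun _ => 0 := by
  funext x
  rw [compCoeff, ha γ (by omega), Finset.sum_eq_zero]
  · simp [vfOp]
  · intro k _
    split_ifs with h
    · rw [ha, mul_zero]
      have := sum_add_single (γ - Pi.single k 1) k
      rw [sub_single_add_single h] at this
      omega
    · rfl

/-- By Leibniz, `Z` either differentiates a coefficient or adds one derivative `∂_k`. Reindexing the
latter terms by `γ ↦ γ + e_k` yields `compCoeff`. -/
theorem sum_compCoeff (hU : IsOpen U) {Z : Rn n → Rn n}
    {a : (Fin n → ℕ) → Rn n → ℝ} (ha : ∀ γ, ContDiffOn ℝ ∞ (a γ) U) {m : ℕ}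
    (ham : ∀ γ : Fin n → ℕ, m < ∑ i, γ i → a γ = fun _ => 0) {u : Rn n → ℝ}
    (hu : ContDiffOn ℝ ∞ u U) {x : Rn n} (hx : x ∈ U) :
    vfOp Z (fun y => ∑ γ ∈ multiOrders n m, a γ y * listOp pd (expand γ) u y) x =
      ∑ γ ∈ multiOrders n (m + 1), compCoeff Z a γ x * listOp pd (expand γ) u x := by
  have hd : ∀ γ, DifferentiableAt ℝ (fun y => a γ y * listOp pd (expand γ) u y) x := fun γ =>
    SmoothOn.differentiableAt hU ((ha γ).mul (contDiffOn_listOp_pd hU hu _)) hx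
  have hlhs : vfOp Z (fun y => ∑ γ ∈ multiOrders n m, a γ y * listOp pd (expand γ) u y) x =
      ∑ γ ∈ multiOrders n m, (vfOp Z (a γ) x * listOp pd (expand γ) u x +
        ∑ k, Z x k * a γ x * listOp pd (expand (γ + Pi.single k 1)) u x) := by
    have : vfOp Z (fun y => ∑ γ ∈ multiOrders n m, a γ y * listOp pd (expand γ) u y) x =
        ∑ γ ∈ multiOrders n m, vfOp Z (fun y => a γ y * listOp pd (expand γ) u y) x := by
      simp only [vfOp]
      rw [fderiv_fun_sum fun γ _ => hd γ]
      simp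
    rw [this]
    refine Finset.sum_congr rfl fun γ _ => ?_
    have hprod : vfOp Z (fun y => a γ y * listOp pd (expand γ) u y) x =
        vfOp Z (a γ) x * listOp pd (expand γ) u x + a γ x * vfOp Z (listOp pd (expand γ) u) x := by
      simp only [vfOp]
      rw [fderiv_fun_mul (SmoothOn.differentiableAt hU (ha γ) hx)
        (SmoothOn.differentiableAt hU (contDiffOn_listOp_pd hU hu _) hx)]
      simp only [FunLike.coe_add, FunLike.coe_smul, Pi.add_apply,
        Pi.smul_apply, smul_eq_mul]
      ring
    rw [hprod, vfOp_eq_sum Z (listOp pd (expand γ) u), Finset.mul_sum]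
    congr 1
    refine Finset.sum_congr rfl fun k _ => ?_
    rw [listOp_pd_perm hU (expand_add_single_perm γ k) hu hx, listOp_cons]
    ring
  rw [hlhs]
  simp only [compCoeff, add_mul, Finset.sum_add_distrib, Finset.sum_mul]
  congr 1
  · refine Finset.sum_subset (fun γ hγ => ?_) fun γ _ hγ => ?_
    · rw [mem_multiOrders] at hγ ⊢
      omega
    · rw [mem_multiOrders, not_le] at hγ
      rw [ham γ hγ]
      simp [vfOp]
  · rw [Finset.sum_comm, Finset.sum_comm (s := multiOrders n (m + 1))]
    refine Finset.sum_congr rfl fun k _ => ?_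
    simp only [ite_mul, zero_mul]
    rw [← Finset.sum_filter]
    refine Finset.sum_bij' (fun γ _ => γ + Pi.single k 1) (fun γ _ => γ - Pi.single k 1)
      ?_ ?_ ?_ ?_ ?_
    · intro γ hγ
      rw [mem_multiOrders] at hγ
      rw [Finset.mem_filter, mem_multiOrders, sum_add_single]
      simp [hγ]
    · intro γ hγ
      rw [Finset.mem_filter, mem_multiOrders] at hγ
      have := sum_add_single (γ - Pi.single k 1) k
      rw [sub_single_add_single hγ.2] at this
      rw [mem_multiOrders]
      omega
    · intro γ _
      simp
    · intro γ hγ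
      rw [Finset.mem_filter] at hγ
      exact sub_single_add_single hγ.2
    · intro γ _
      simp

/-- The value 1 at the multi-index counting `I` is carried along because it later makes the weight
exact. Smoothness and vanishing above order `I.length` are needed to keep the recursion going. -/
theorem exists_coeff_listOp (hU : IsOpen U) (h0 : (0 : Rn n) ∈ U)
    (hY : ∀ j, ContDiffOn ℝ ∞ (Y j) U) (hY0 : ∀ j, Y j 0 = EuclideanSpace.single j (1 : ℝ))
    (hYw : ComponentsVanish w Y) (I : List (Fin n)) :
    ∃ a : (Fin n → ℕ) → Rn n → ℝ, (∀ γ, ContDiffOn ℝ ∞ (a γ) U) ∧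
      (∀ γ : Fin n → ℕ, I.length < ∑ i, γ i → a γ = fun _ => 0) ∧
      (∀ γ, VanishesTo (intWeight w) (a γ) (wlen w γ - (I.map (intWeight w)).sum)) ∧
      a (fun i => I.count i) 0 = 1 ∧
      ∀ u : Rn n → ℝ, ContDiffOn ℝ ∞ u U → ∀ x ∈ U, listOp (fun i => vfOp (Y i)) I u x =
        ∑ γ ∈ multiOrders n I.length, a γ x * listOp pd (expand γ) u x := by
  induction I with
  | nil =>
    have hne : ∀ γ : Fin n → ℕ, γ ≠ 0 ↔ 0 < ∑ i, γ i := fun γ => by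
      rw [Nat.pos_iff_ne_zero, not_iff_not, Finset.sum_eq_zero_iff]
      simp [funext_iff]
    refine ⟨fun γ _ => if γ = 0 then 1 else 0, fun γ => contDiffOn_const, fun γ hγ => ?_,
      fun γ => ?_, ?_, fun u _ x _ => ?_⟩
    · simp [(hne γ).2 hγ]
    · by_cases hγ : γ = 0
      · subst hγ
        exact VanishesTo.of_nonpos (fun _ => by simp) (by simp [wlen])
      · simpa [hγ] using vanishesTo_zero
    · simp [funext_iff]
    · have : (0 : Fin n → ℕ) ∈ multiOrders n 0 := mem_multiOrders.2 (by simp)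
      simp only [List.length_nil, ite_mul, one_mul, zero_mul, Finset.sum_ite_eq', this, if_true,
        expand_zero, listOp_nil]
  | cons j I ih =>
    obtain ⟨a, ha, ham, hav, ha1, hau⟩ := ih
    refine ⟨compCoeff (Y j) a, contDiffOn_compCoeff hU (hY j) ha,
      fun γ hγ => compCoeff_eq_zero ham hγ, fun γ => ?_, ?_, fun u hu x hx => ?_⟩
    · refine VanishesTo.add hU h0 (contDiffOn_vfOp hU (hY j) (ha γ))
        (ContDiffOn.sum fun k _ => ?_) ?_ (VanishesTo.sum hU h0 _ (fun k _ => ?_) fun k _ => ?_)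
      · by_cases h : 1 ≤ γ k
        · simpa only [h, if_true] using (contDiffOn_coord (hY j) k).mul (ha _)
        · simpa only [h, if_false] using contDiffOn_const
      · refine ((hav γ).vfOp hU h0 hY hYw (ha γ) j).mono (le_of_eq ?_)
        simp only [List.map_cons, List.sum_cons]
        ring
      · by_cases h : 1 ≤ γ k
        · simpa only [h, if_true] using (contDiffOn_coord (hY j) k).mul (ha _)
        · simpa only [h, if_false] using contDiffOn_const
      · by_cases h : 1 ≤ γ k
        · simp only [h, if_true]
          refine (VanishesTo.mul hU h0 (contDiffOn_coord (hY j) k) (ha _) (hYw j k)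
            (hav _)).mono (le_of_eq ?_)
          have := wlen_add_single (w := w) (γ - Pi.single k 1) k
          rw [sub_single_add_single h] at this
          rw [this]
          simp only [List.map_cons, List.sum_cons]
          push_cast
          ring
        · simpa only [h, if_false] using vanishesTo_zero
    -- The multi-index has one order too many for `a`, so the term differentiating a coefficient
    -- drops out; at the origin only `k = j` survives.
    · rw [count_cons_eq, compCoeff, ham, Finset.sum_eq_single j]
      · simp [hY0, ha1, vfOp]
      · intro k _ hk
        simp [hY0, hk]
      · simp
      · rw [sum_add_single, sum_count]
        omega
    · rw [listOp_cons, vfOp_congr hU (hau u hu) (Y j) hx, sum_compCoeff hU ha ham hu hx]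
      rfl

theorem ComponentsVanish.diffOpHasWeight_monomial (hU : IsOpen U) (h0 : (0 : Rn n) ∈ U)
    (hY : ∀ j, ContDiffOn ℝ ∞ (Y j) U) (hY0 : ∀ j, Y j 0 = EuclideanSpace.single j (1 : ℝ))
    (hYw : ComponentsVanish w Y) (α : Fin n → ℕ) :
    DiffOpHasWeight w U (monomial (fun j => vfOp (Y j)) α) (-(wlen w α : ℤ)) := by
  obtain ⟨a, ha, -, hav, ha1, hau⟩ := exists_coeff_listOp hU h0 hY hY0 hYw (expand α)
  simp only [count_expand] at ha1
  have hwα : ((expand α).map (intWeight w)).sum = wlen w α := (wlen_eq_sum w α).symm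
  have haw : ∀ γ, WeightGE w (a γ) (-(wlen w α : ℤ) + wlen w γ) := fun γ => by
    rw [weightGE_iff hU h0 (ha γ)]
    exact (hav γ).mono (by omega)
  refine ⟨(expand α).length, a, ⟨fun γ _ => ha γ, fun u hu x hx => ?_⟩, fun γ _ => haw γ,
    α, ?_, haw α, 0, ?_, ?_⟩
  · simp only [monomial_eq_listOp, partialDeriv_eq_listOp]
    exact hau u hu x hx
  · rw [mem_multiOrders, length_expand]
  · simp [wlen]
  · rw [partialDeriv_eq_listOp, expand_zero, listOp_nil, ha1]
    exact one_ne_zero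

theorem monomial_single {F : Type*} (D : Fin n → F → F) (j : Fin n) :
    monomial D (Pi.single j 1) = D j := by
  funext f
  rw [monomial_eq_listOp, expand_single]
  rfl

theorem wlen_single (j : Fin n) : wlen w (Pi.single j 1) = w j := by
  simp [wlen, Pi.single_apply]

end DiffOp

/-! ### Anisotropic dilations and rescaled derivatives -/

section Dilation

variable {n : ℕ} {U : Set (Rn n)} {w : Fin n → ℕ}

@[simp] theorem dilation_apply (w : Fin n → ℕ) (t : ℝ) (x : Rn n) (k : Fin n) :
    dilation w t x k = t ^ w k * x k := rfl

@[simp] theorem dilation_origin (t : ℝ) : dilation w t (0 : Rn n) = 0 := by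
  ext k
  simp

theorem dilation_zero (hw : ∀ k, 1 ≤ w k) (x : Rn n) : dilation w 0 x = 0 := by
  ext k
  have := hw k
  rw [dilation_apply, zero_pow (by omega), zero_mul]
  rfl

/-- The dilation `δ_t`, `t ≠ 0`, as a linear automorphism. -/
def dilationEquiv (w : Fin n → ℕ) {t : ℝ} (ht : t ≠ 0) : Rn n ≃L[ℝ] Rn n :=
  LinearEquiv.toContinuousLinearEquiv
    { toFun := dilation w t
      invFun := dilation w t⁻¹
      map_add' := fun x y => by ext k; simp [mul_add]
      map_smul' := fun c x => by ext k; simp; ring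
      left_inv := fun x => by ext k; simp [ht]
      right_inv := fun x => by ext k; simp [ht] }

theorem dilationEquiv_coe (w : Fin n → ℕ) {t : ℝ} (ht : t ≠ 0) :
    ⇑(dilationEquiv w ht) = dilation w t := rfl

theorem hasFDerivAt_dilation (w : Fin n → ℕ) {t : ℝ} (ht : t ≠ 0) (x : Rn n) :
    HasFDerivAt (dilation w t) (dilationEquiv w ht : Rn n →L[ℝ] Rn n) x :=
  (dilationEquiv w ht).hasFDerivAt

theorem contDiff_dilation (w : Fin n → ℕ) {t : ℝ} (ht : t ≠ 0) : ContDiff ℝ ∞ (dilation w t) :=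
  (dilationEquiv w ht).contDiff

theorem pullback_dilation (Z : Rn n → Rn n) {t : ℝ} (ht : t ≠ 0) (x : Rn n) (k : Fin n) :
    VectorField.pullback ℝ (dilation w t) Z x k = (t ^ w k)⁻¹ * Z (dilation w t x) k := by
  rw [VectorField.pullback, (hasFDerivAt_dilation w ht x).fderiv,
    ContinuousLinearMap.inverse_equiv]
  change dilation w t⁻¹ _ k = _
  rw [dilation_apply, inv_pow]

theorem isOpen_dilation_preimage (hU : IsOpen U) {t : ℝ} (ht : t ≠ 0) :
    IsOpen (dilation w t ⁻¹' U) :=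
  hU.preimage (contDiff_dilation w ht).continuous

theorem contDiffOn_comp_dilation {f : Rn n → ℝ} (hf : ContDiffOn ℝ ∞ f U) {t : ℝ} (ht : t ≠ 0) :
    ContDiffOn ℝ ∞ (fun x => f (dilation w t x)) (dilation w t ⁻¹' U) :=
  hf.comp (contDiff_dilation w ht).contDiffOn fun _ h => h

theorem dilation_single (t : ℝ) (i : Fin n) :
    dilation w t (EuclideanSpace.single i 1) = t ^ w i • EuclideanSpace.single i (1 : ℝ) := by
  ext k
  by_cases h : k = i
  · subst h; simp
  · simp [h]

theorem pd_comp_dilation (hU : IsOpen U) {f : Rn n → ℝ} (hf : ContDiffOn ℝ ∞ f U) {t : ℝ}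
    (ht : t ≠ 0) (i : Fin n) {x : Rn n} (hx : dilation w t x ∈ U) :
    pd i (fun y => f (dilation w t y)) x = t ^ w i * pd i f (dilation w t x) := by
  have h := ((SmoothOn.differentiableAt hU hf hx).hasFDerivAt.comp x
    (hasFDerivAt_dilation w ht x)).fderiv
  simp only [pd, vfOp]
  change fderiv ℝ (f ∘ dilation w t) x _ = _
  rw [h, ContinuousLinearMap.comp_apply, ContinuousLinearEquiv.coe_coe, dilationEquiv_coe,
    dilation_single, map_smul, smul_eq_mul]

theorem listOp_pd_rescale_sub (hU : IsOpen U) {f G : Rn n → ℝ} (hf : ContDiffOn ℝ ∞ f U)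
    (hG : ContDiff ℝ ∞ G) {t : ℝ} (ht : t ≠ 0) (c : ℤ) (I : List (Fin n)) :
    Set.EqOn (listOp pd I fun y => t ^ c * f (dilation w t y) - G y)
      (fun y => t ^ (c + (I.map (intWeight w)).sum) * listOp pd I f (dilation w t y) -
        listOp pd I G y) (dilation w t ⁻¹' U) := by
  have hV := isOpen_dilation_preimage (w := w) hU ht
  induction I with
  | nil => intro x _; simp
  | cons i I ih =>
    refine (vfOp_congr hV ih _).trans fun x hx => ?_
    have h₁ : DifferentiableAt ℝ (fun y => listOp pd I f (dilation w t y)) x :=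
      SmoothOn.differentiableAt hV (contDiffOn_comp_dilation (contDiffOn_listOp_pd hU hf I) ht) hx
    have h₂ : DifferentiableAt ℝ (listOp pd I G) x :=
      SmoothOn.differentiableAt isOpen_univ
        (contDiffOn_listOp_pd isOpen_univ hG.contDiffOn I) (Set.mem_univ x)
    have h₃ := pd_comp_dilation hU (contDiffOn_listOp_pd hU hf I) ht i hx
    simp only [pd, vfOp, listOp_cons] at h₃ ⊢
    rw [fderiv_fun_sub (h₁.const_mul _) h₂, fderiv_const_mul h₁]
    simp only [FunLike.coe_sub, FunLike.coe_smul, Pi.sub_apply, Pi.smul_apply, smul_eq_mul]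
    rw [h₃]
    simp only [List.map_cons, List.sum_cons]
    rw [show c + (intWeight w i + (I.map (intWeight w)).sum) =
      c + (I.map (intWeight w)).sum + w i by rw [intWeight]; ring, zpow_add₀ ht _ (w i : ℤ),
      zpow_natCast]
    ring

theorem norm_dilation_le (hw : ∀ k, 1 ≤ w k) {t : ℝ} (ht : |t| ≤ 1) (x : Rn n) :
    ‖dilation w t x‖ ≤ |t| * ‖x‖ := by
  refine abs_le_of_sq_le_sq' ?_ (by positivity) |>.2
  rw [mul_pow, EuclideanSpace.norm_sq_eq, EuclideanSpace.norm_sq_eq, Finset.mul_sum]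
  refine Finset.sum_le_sum fun k _ => ?_
  rw [dilation_apply, norm_mul, norm_pow, mul_pow, Real.norm_eq_abs t]
  gcongr
  exact pow_le_of_le_one (abs_nonneg t) ht (by have := hw k; omega)

/-- Small dilations contract `K` into a closed ball about the origin inside `U`. The same constants
then serve every function and derivative. -/
theorem exists_dilation_mem (hU : IsOpen U) (h0 : (0 : Rn n) ∈ U) (hw : ∀ k, 1 ≤ w k)
    {K : Set (Rn n)} (hK : IsCompact K) :
    ∃ (L : Set (Rn n)) (ε R : ℝ), IsCompact L ∧ L ⊆ U ∧ 0 < ε ∧ ε ≤ 1 ∧ 0 ≤ R ∧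
      (∀ x ∈ K, ∀ k, |x k| ≤ R) ∧ ∀ x ∈ K, ∀ t : ℝ, |t| ≤ ε → dilation w t x ∈ L := by
  obtain ⟨r, hr, hrU⟩ := Metric.nhds_basis_closedBall.mem_iff.1 (hU.mem_nhds h0)
  obtain ⟨R, hR, hKR⟩ := hK.isBounded.exists_pos_norm_le
  refine ⟨Metric.closedBall 0 r, min 1 (r / R), R, isCompact_closedBall 0 r, hrU,
    lt_min one_pos (div_pos hr hR), min_le_left _ _, hR.le, fun x hx k => ?_, fun x hx t ht => ?_⟩
  · exact (PiLp.norm_apply_le x k).trans (hKR x hx)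
  · rw [mem_closedBall_zero_iff]
    refine (norm_dilation_le hw (ht.trans (min_le_left _ _)) x).trans ?_
    calc |t| * ‖x‖ ≤ r / R * R :=
          mul_le_mul (ht.trans (min_le_right _ _)) (hKR x hx) (norm_nonneg _) (by positivity)
      _ = r := div_mul_cancel₀ _ hR.ne'

end Dilation

/-! ### The homogeneous part of the Taylor expansion -/

section HomPart

variable {n : ℕ} {U : Set (Rn n)} {w : Fin n → ℕ} {f g : Rn n → ℝ} {N : ℤ}

/-- The homogeneous part of degree `N` of the Taylor expansion of `f` at `0`, defined recursively
through Euler's identity. -/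
def homPart (w : Fin n → ℕ) (f : Rn n → ℝ) (N : ℤ) (x : Rn n) : ℝ :=
  if _hN : N < 0 then 0
  else if _hN' : N = 0 then f 0
  else (N : ℝ)⁻¹ * ∑ k, if _hk : 0 < w k then w k * x k * homPart w (pd k f) (N - w k) x else 0
termination_by N.toNat
decreasing_by omega

theorem homPart_of_neg (hN : N < 0) (x : Rn n) : homPart w f N x = 0 := by
  rw [homPart, dif_pos hN]

theorem homPart_zero (x : Rn n) : homPart w f 0 x = f 0 := by
  rw [homPart, dif_neg (lt_irrefl _), dif_pos rfl]

theorem homPart_of_pos (hw : ∀ k, 1 ≤ w k) (hN : 0 < N) (x : Rn n) :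
    homPart w f N x = (N : ℝ)⁻¹ * ∑ k, w k * x k * homPart w (pd k f) (N - w k) x := by
  rw [homPart, dif_neg hN.not_gt, dif_neg hN.ne']
  congr 1
  exact Finset.sum_congr rfl fun k _ => dif_pos (hw k)

theorem euler_homPart (hw : ∀ k, 1 ≤ w k) (x : Rn n) :
    (N : ℝ) * homPart w f N x = ∑ k, w k * x k * homPart w (pd k f) (N - w k) x := by
  rcases le_or_gt N 0 with hN | hN
  · rw [Finset.sum_eq_zero fun k _ => by
      rw [homPart_of_neg (by have := hw k; omega), mul_zero]]
    rcases hN.eq_or_lt with rfl | hN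
    · simp
    · rw [homPart_of_neg hN, mul_zero]
  · have : (N : ℝ) ≠ 0 := by exact_mod_cast hN.ne'
    rw [homPart_of_pos hw hN, mul_inv_cancel_left₀ this]

/-- Induction on the degree: negative degrees, degree zero, and positive degrees. -/
theorem degree_induction (hw : ∀ k, 1 ≤ w k) {p : ℤ → (Rn n → ℝ) → Prop}
    (hneg : ∀ N < 0, ∀ f, p N f) (hzero : ∀ f, p 0 f)
    (hpos : ∀ N > 0, (∀ k f, p (N - w k) f) → ∀ f, p N f) (N : ℤ) (f : Rn n → ℝ) : p N f := by
  have key : ∀ m : ℕ, ∀ N : ℤ, N ≤ m → ∀ f, p N f := by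
    intro m
    induction m with
    | zero =>
      intro N hN f
      rcases hN.eq_or_lt with rfl | hN
      · exact hzero f
      · exact hneg N hN f
    | succ m ih =>
      intro N hN f
      rcases lt_trichotomy N 0 with h | rfl | h
      · exact hneg N h f
      · exact hzero f
      · exact hpos N h (fun k g => ih _ (by have := hw k; push_cast at hN; omega) g) f
  exact key N.toNat N (Int.self_le_toNat N) f

theorem homPart_congr (hw : ∀ k, 1 ≤ w k) (hU : IsOpen U) (h0 : (0 : Rn n) ∈ U)
    (hfg : Set.EqOn f g U) (x : Rn n) : homPart w f N x = homPart w g N x := by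
  refine degree_induction (p := fun N f => ∀ g, Set.EqOn f g U →
    homPart w f N x = homPart w g N x) hw ?_ ?_ ?_ N f g hfg
  · intro N hN f g _
    rw [homPart_of_neg hN, homPart_of_neg hN]
  · intro f g h
    rw [homPart_zero, homPart_zero, h h0]
  · intro N hN ih f g h
    rw [homPart_of_pos hw hN, homPart_of_pos hw hN]
    congr 1
    refine Finset.sum_congr rfl fun k _ => ?_
    rw [ih k (pd k f) (pd k g) (vfOp_congr hU h _)]

theorem contDiff_homPart (hw : ∀ k, 1 ≤ w k) (f : Rn n → ℝ) (N : ℤ) :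
    ContDiff ℝ ∞ (homPart w f N) := by
  refine degree_induction (p := fun N f => ContDiff ℝ ∞ (homPart w f N)) hw ?_ ?_ ?_ N f
  · intro N hN f
    rw [funext (homPart_of_neg hN)]
    exact contDiff_const
  · intro f
    rw [funext homPart_zero]
    exact contDiff_const
  · intro N hN ih f
    rw [funext (homPart_of_pos hw hN)]
    exact contDiff_const.mul (ContDiff.sum fun k _ =>
      (contDiff_const.mul (contDiff_coord k)).mul (ih k _))

theorem homPart_dilation (hw : ∀ k, 1 ≤ w k) {t : ℝ} (ht : t ≠ 0) (f : Rn n → ℝ) (N : ℤ)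
    (x : Rn n) : homPart w f N (dilation w t x) = t ^ N * homPart w f N x := by
  refine degree_induction (p := fun N f => homPart w f N (dilation w t x) =
    t ^ N * homPart w f N x) hw ?_ ?_ ?_ N f
  · intro N hN f
    rw [homPart_of_neg hN, homPart_of_neg hN, mul_zero]
  · intro f
    simp [homPart_zero]
  · intro N hN ih f
    rw [homPart_of_pos hw hN, homPart_of_pos hw hN, mul_left_comm]
    congr 1
    rw [Finset.mul_sum]
    refine Finset.sum_congr rfl fun k _ => ?_
    rw [ih k, dilation_apply, zpow_sub₀ ht, zpow_natCast]
    field_simp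

theorem pd_const_mul_sum {ι : Type*} [Fintype ι] (c : ℝ) (i : Fin n) {G : ι → Rn n → ℝ}
    {x : Rn n} (hG : ∀ k, DifferentiableAt ℝ (G k) x) :
    pd i (fun y => c * ∑ k, G k y) x = c * ∑ k, pd i (G k) x := by
  simp only [pd, vfOp]
  rw [fderiv_const_mul (DifferentiableAt.fun_sum fun k _ => hG k), fderiv_fun_sum fun k _ => hG k]
  simp

/-- Differentiating the Euler recursion gives `w i` copies of the claimed function from the factor
`x_i`. Euler's identity for `∂_i f` gives `N - w i` more; together these cancel the prefactor `1 /
N`. -/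
theorem pd_homPart (hw : ∀ k, 1 ≤ w k) (hU : IsOpen U) (h0 : (0 : Rn n) ∈ U)
    (hf : ContDiffOn ℝ ∞ f U) (i : Fin n) :
    pd i (homPart w f N) = homPart w (pd i f) (N - w i) := by
  refine degree_induction (p := fun N f => ContDiffOn ℝ ∞ f U →
    pd i (homPart w f N) = homPart w (pd i f) (N - w i)) hw ?_ ?_ ?_ N f hf
  · intro N hN f _
    rw [funext (homPart_of_neg hN), pd_const]
    funext x
    rw [homPart_of_neg (by omega)]
  · intro f _
    rw [funext homPart_zero, pd_const]
    funext x
    rw [homPart_of_neg (by have := hw i; omega)]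
  · intro N hN ih f hf
    funext x
    have hN0 : (N : ℝ) ≠ 0 := by exact_mod_cast hN.ne'
    have hd : ∀ k, DifferentiableAt ℝ (homPart w (pd k f) (N - w k)) x := fun k =>
      (contDiff_homPart hw _ _).differentiable (by simp) x
    have hc : ∀ k, DifferentiableAt ℝ (fun y : Rn n => y k) x := fun k =>
      (contDiff_coord k).differentiable (by simp) x
    have hprod : ∀ k, pd i (fun y => w k * y k * homPart w (pd k f) (N - w k) y) x =
        (if i = k then (w k : ℝ) * homPart w (pd k f) (N - w k) x else 0) +
          w k * x k * homPart w (pd k (pd i f)) (N - w i - w k) x := by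
      intro k
      specialize hd k
      have h₁ := congrFun (ih k (pd k f) (contDiffOn_pd hU hf k)) x
      have h₂ := congrFun (pd_coord i k) x
      rw [homPart_congr hw hU h0 (pd_comm hU hf i k),
        show N - (w k : ℤ) - w i = N - w i - w k by ring] at h₁
      generalize homPart w (pd k f) (N - w k) = G at h₁ hd ⊢
      simp only [pd, vfOp] at h₁ h₂ ⊢
      rw [fderiv_fun_mul ((hc k).const_mul _) hd, fderiv_const_mul (hc k)]
      simp only [FunLike.coe_add, FunLike.coe_smul, Pi.add_apply, Pi.smul_apply, smul_eq_mul]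
      rw [h₂, h₁]
      split_ifs <;> ring
    have hsum : pd i (homPart w f N) x = (N : ℝ)⁻¹ *
        ∑ k, pd i (fun y => w k * y k * homPart w (pd k f) (N - w k) y) x := by
      rw [funext (homPart_of_pos hw hN)]
      exact pd_const_mul_sum _ _ fun k => ((hc k).const_mul _).fun_mul (hd k)
    rw [hsum]
    simp only [hprod, Finset.sum_add_distrib, Finset.sum_ite_eq, Finset.mem_univ, if_true]
    rw [← euler_homPart hw]
    push_cast
    field_simp
    ring

theorem listOp_pd_homPart (hw : ∀ k, 1 ≤ w k) (hU : IsOpen U) (h0 : (0 : Rn n) ∈ U)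
    (hf : ContDiffOn ℝ ∞ f U) (I : List (Fin n)) :
    listOp pd I (homPart w f N) = homPart w (listOp pd I f) (N - (I.map (intWeight w)).sum) := by
  induction I with
  | nil => simp
  | cons i I ih =>
    rw [listOp_cons, ih, pd_homPart hw hU h0 (contDiffOn_listOp_pd hU hf I)]
    simp only [List.map_cons, List.sum_cons, listOp_cons, intWeight]
    congr 1
    ring

theorem hasDerivAt_comp_dilation (hU : IsOpen U) (hf : ContDiffOn ℝ ∞ f U) {x : Rn n} {s : ℝ}
    (hs : dilation w s x ∈ U) :
    HasDerivAt (fun t => f (dilation w t x))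
      (∑ k, w k * x k * (s ^ (w k - 1) * pd k f (dilation w s x))) s := by
  have hγ : HasDerivAt (fun t => dilation w t x)
      (WithLp.toLp 2 fun k => (w k * s ^ (w k - 1)) * x k) s := by
    have h : HasDerivAt (fun t k => t ^ w k * x k) (fun k => (w k * s ^ (w k - 1)) * x k) s :=
      hasDerivAt_pi.2 fun k => (hasDerivAt_pow (w k) s).mul_const (x k)
    exact (PiLp.hasFDerivAt_toLp (𝕜 := ℝ) (E := fun _ : Fin n => ℝ) 2
      (fun k => s ^ w k * x k)).comp_hasDerivAt s h
  have h := (SmoothOn.differentiableAt hU hf hs).hasFDerivAt.comp_hasDerivAt s hγ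
  refine h.congr_deriv ?_
  have := vfOp_eq_sum (fun _ => WithLp.toLp 2 fun k => (w k * s ^ (w k - 1)) * x k) f
    (dilation w s x)
  rw [vfOp] at this
  rw [this]
  exact Finset.sum_congr rfl fun k _ => by simp only; ring

theorem exists_bound_comp_dilation {K L : Set (Rn n)} {ε : ℝ} (hL : IsCompact L) (hLU : L ⊆ U)
    (hKL : ∀ x ∈ K, ∀ t : ℝ, |t| ≤ ε → dilation w t x ∈ L) (hf : ContDiffOn ℝ ∞ f U) :
    ∃ B : ℝ, 0 ≤ B ∧ ∀ x ∈ K, ∀ t : ℝ, |t| ≤ ε → |f (dilation w t x)| ≤ B := by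
  obtain ⟨B, hB⟩ := hL.exists_bound_of_continuousOn (hf.continuousOn.mono hLU)
  exact ⟨max B 0, le_max_right _ _, fun x hx t ht => (hB _ (hKL x hx t ht)).trans (le_max_left _ _)⟩

/-- Mean value inequality in the dilation parameter. The derivative of the remainder is a
combination of remainders of the `∂_k f`, to which strong induction applies because `w k ≥ 1`. -/
theorem exists_taylor_bound (hw : ∀ k, 1 ≤ w k) (hU : IsOpen U) {K L : Set (Rn n)} {ε R : ℝ}
    (hL : IsCompact L) (hLU : L ⊆ U) (hε : ε ≤ 1) (hR : 0 ≤ R) (hKR : ∀ x ∈ K, ∀ k, |x k| ≤ R)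
    (hKL : ∀ x ∈ K, ∀ t : ℝ, |t| ≤ ε → dilation w t x ∈ L) (p : ℕ) (hf : ContDiffOn ℝ ∞ f U)
    (hfp : VanishesTo (intWeight w) f p) :
    ∃ C : ℝ, 0 ≤ C ∧ ∀ x ∈ K, ∀ t : ℝ, |t| ≤ ε →
      |f (dilation w t x) - t ^ p * homPart w f p x| ≤ C * |t| ^ (p + 1) := by
  induction p using Nat.strong_induction_on generalizing f with
  | _ p ih =>
  have hk : ∀ k, ∃ C : ℝ, 0 ≤ C ∧ ∀ x ∈ K, ∀ s : ℝ, |s| ≤ ε →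
      |s ^ (w k - 1) * pd k f (dilation w s x) - s ^ (p - 1) * homPart w (pd k f) (p - w k) x| ≤
        C * |s| ^ p := by
    intro k
    have hwk := hw k
    rcases le_or_gt (w k) p with h | h
    · have hcast : ((p - w k : ℕ) : ℤ) = p - w k := by omega
      obtain ⟨C, hC0, hC⟩ := ih (p - w k) (by omega) (contDiffOn_pd hU hf k)
        (by rw [hcast]; exact hfp.pd k)
      refine ⟨C, hC0, fun x hx s hs => ?_⟩
      have := hC x hx s hs
      rw [hcast] at this
      rw [show p - 1 = (w k - 1) + (p - w k) by omega, pow_add, mul_assoc, ← mul_sub, abs_mul,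
        abs_pow]
      calc |s| ^ (w k - 1) * _ ≤ |s| ^ (w k - 1) * (C * |s| ^ (p - w k + 1)) := by gcongr
        _ = C * |s| ^ (w k - 1 + (p - w k + 1)) := by rw [pow_add]; ring
        _ = C * |s| ^ p := by congr 2; omega
    -- Here the homogeneous part has negative degree and is zero, while `w k - 1 ≥ p` makes the
    -- factor `s ^ (w k - 1)` small enough.
    · obtain ⟨B, hB0, hB⟩ := exists_bound_comp_dilation hL hLU hKL (contDiffOn_pd hU hf k)
      refine ⟨B, hB0, fun x hx s hs => ?_⟩
      rw [homPart_of_neg (by omega), mul_zero, sub_zero, abs_mul, abs_pow, mul_comm]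
      exact mul_le_mul (hB x hx s hs)
        (pow_le_pow_of_le_one (abs_nonneg s) (hs.trans hε) (by omega)) (by positivity) hB0
  choose C hC0 hC using hk
  refine ⟨∑ k, w k * R * C k, Finset.sum_nonneg fun k _ => by have := hC0 k; positivity,
    fun x hx t ht => ?_⟩
  -- The symmetric interval contains both 0 and `t` whatever the sign of `t`.
  have hderiv : ∀ s ∈ Set.Icc (-|t|) |t|, HasDerivWithinAt
      (fun s => f (dilation w s x) - s ^ p * homPart w f p x)
      (∑ k, w k * x k * (s ^ (w k - 1) * pd k f (dilation w s x) -
        s ^ (p - 1) * homPart w (pd k f) (p - w k) x)) (Set.Icc (-|t|) |t|) s := by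
    intro s hs
    have hs' : |s| ≤ ε := (abs_le.2 hs).trans ht
    refine HasDerivAt.hasDerivWithinAt ?_
    refine ((hasDerivAt_comp_dilation hU hf (hLU (hKL x hx s hs'))).sub
      ((hasDerivAt_pow p s).mul_const (homPart w f p x))).congr_deriv ?_
    have he := euler_homPart (f := f) (N := p) hw x
    rw [Int.cast_natCast] at he
    simp only [mul_sub, Finset.sum_sub_distrib]
    congr 1
    rw [mul_right_comm, he, Finset.sum_mul]
    exact Finset.sum_congr rfl fun k _ => by ring
  have hbound : ∀ s ∈ Set.Icc (-|t|) |t|, ‖∑ k, w k * x k *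
      (s ^ (w k - 1) * pd k f (dilation w s x) -
        s ^ (p - 1) * homPart w (pd k f) (p - w k) x)‖ ≤ (∑ k, w k * R * C k) * |t| ^ p := by
    intro s hs
    have hst : |s| ≤ |t| := abs_le.2 hs
    rw [Finset.sum_mul]
    refine (norm_sum_le _ _).trans (Finset.sum_le_sum fun k _ => ?_)
    rw [Real.norm_eq_abs, abs_mul, abs_mul, Nat.abs_cast, mul_assoc (_ * _) (C k)]
    have hCk := hC0 k
    refine mul_le_mul (mul_le_mul_of_nonneg_left (hKR x hx k) (by positivity))
      ((hC k x hx s (hst.trans ht)).trans ?_) (abs_nonneg _) (by positivity)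
    gcongr
  have hmvt := (convex_Icc (-|t|) |t|).norm_image_sub_le_of_norm_hasDerivWithin_le hderiv hbound
    (x := 0) (y := t) (by simp) ⟨neg_abs_le t, le_abs_self t⟩
  have hzero : f (dilation w 0 x) - 0 ^ p * homPart w f p x = 0 := by
    rw [dilation_zero hw]
    rcases Nat.eq_zero_or_pos p with rfl | hp
    · rw [Nat.cast_zero, homPart_zero]
      ring
    · rw [(vanishesTo_iff_pd.1 hfp).1 (by exact_mod_cast hp), zero_pow hp.ne', zero_mul, sub_zero]
  rw [hzero, sub_zero, sub_zero, Real.norm_eq_abs, Real.norm_eq_abs, mul_assoc, ← pow_succ] at hmvt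
  exact hmvt

theorem exists_rescale_bound (hw : ∀ k, 1 ≤ w k) (hU : IsOpen U) {K L : Set (Rn n)} {ε R : ℝ}
    (hL : IsCompact L) (hLU : L ⊆ U) (hε : ε ≤ 1) (hR : 0 ≤ R) (hKR : ∀ x ∈ K, ∀ k, |x k| ≤ R)
    (hKL : ∀ x ∈ K, ∀ t : ℝ, |t| ≤ ε → dilation w t x ∈ L) (hf : ContDiffOn ℝ ∞ f U)
    (hfN : VanishesTo (intWeight w) f N) :
    ∃ C : ℝ, ∀ x ∈ K, ∀ t : ℝ, t ≠ 0 → |t| ≤ ε →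
      |t ^ (-N) * f (dilation w t x) - homPart w f N x| ≤ C * |t| := by
  rcases lt_or_ge N 0 with hN | hN
  · obtain ⟨B, hB0, hB⟩ := exists_bound_comp_dilation hL hLU hKL hf
    refine ⟨B, fun x hx t _ ht => ?_⟩
    obtain ⟨q, hq⟩ := Int.eq_ofNat_of_zero_le (show 0 ≤ -N by omega)
    rw [homPart_of_neg hN, sub_zero, hq, zpow_natCast, abs_mul, abs_pow, mul_comm]
    exact mul_le_mul (hB x hx t ht)
      (pow_le_of_le_one (abs_nonneg t) (ht.trans hε) (by omega)) (by positivity) hB0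
  · obtain ⟨p, rfl⟩ := Int.eq_ofNat_of_zero_le hN
    obtain ⟨C, -, hC⟩ := exists_taylor_bound hw hU hL hLU hε hR hKR hKL p hf hfN
    refine ⟨C, fun x hx t ht0 ht => ?_⟩
    have h := hC x hx t ht
    have hpos : 0 < |t| ^ p := pow_pos (abs_pos.2 ht0) p
    have heq : t ^ (-(p : ℤ)) * f (dilation w t x) - homPart w f p x =
        (t ^ p)⁻¹ * (f (dilation w t x) - t ^ p * homPart w f p x) := by
      rw [zpow_neg, zpow_natCast]
      field_simp
    rw [heq, abs_mul, abs_inv, abs_pow, inv_mul_le_iff₀ hpos]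
    refine h.trans_eq ?_
    rw [pow_succ]
    ring

end HomPart

/-! ### Homogeneous models -/

section Model

variable {n : ℕ} {U : Set (Rn n)} {w : Fin n → ℕ} {Y : Rn n → Rn n} {d : ℕ}

theorem rescaled_component (Y Z : Rn n → Rn n) (d : ℕ) {t : ℝ} (ht : t ≠ 0) (k : Fin n) :
    (fun y => (t ^ d • VectorField.pullback ℝ (dilation w t) Y y - Z y) k) =
      fun y => t ^ (-((w k : ℤ) - d)) * Y (dilation w t y) k - Z y k := by
  funext y
  rw [PiLp.sub_apply, PiLp.smul_apply, pullback_dilation Y ht, neg_sub, zpow_sub₀ ht, zpow_natCast,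
    zpow_natCast, smul_eq_mul]
  ring

/-- The model has the Taylor parts of degree `w k - d` as components. Derivatives commute with
taking these parts, so the Taylor bound applied to each derivative gives convergence in every
seminorm. -/
theorem HasHomogeneousModel.of_vanishesTo (hU : IsOpen U) (h0 : (0 : Rn n) ∈ U)
    (hw : ∀ k, 1 ≤ w k) (hY : ContDiffOn ℝ ∞ Y U)
    (h : ∀ k, VanishesTo (intWeight w) (fun x => Y x k) ((w k : ℤ) - d)) :
    HasHomogeneousModel w U Y d := by
  refine ⟨fun x => WithLp.toLp 2 fun k => homPart w (fun y => Y y k) ((w k : ℤ) - d) x, ?_, ?_, ?_⟩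
  · rw [contDiff_euclidean]
    exact fun k => contDiff_homPart hw _ _
  · intro t ht x
    ext k
    rw [pullback_dilation _ ht]
    simp only [PiLp.smul_apply, smul_eq_mul]
    rw [homPart_dilation hw ht, zpow_sub₀ ht, zpow_neg, zpow_natCast, zpow_natCast]
    have : t ^ w k ≠ 0 := pow_ne_zero _ ht
    field_simp
  · intro K hK _ α k
    obtain ⟨L, ε, R, hL, hLU, hε0, hε, hR, hKR, hKL⟩ := exists_dilation_mem hU h0 hw hK
    have hYk := contDiffOn_coord hY k
    obtain ⟨C, hC⟩ := exists_rescale_bound hw hU hL hLU hε hR hKR hKL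
      (contDiffOn_listOp_pd hU hYk (expand α)) ((h k).listOp_pd (expand α))
    refine ⟨C, ?_⟩
    have hev : ∀ᶠ t in 𝓝[≠] (0 : ℝ), |t| < ε :=
      by
      simpa using (eventually_abs_sub_lt (0 : ℝ) hε0).filter_mono nhdsWithin_le_nhds
    filter_upwards [hev, self_mem_nhdsWithin] with t htε ht x hx
    have ht : t ≠ 0 := ht
    rw [partialDeriv_eq_listOp, rescaled_component _ _ d ht,
      listOp_pd_rescale_sub hU hYk (contDiff_homPart hw _ _) ht _ _ (hLU (hKL x hx t htε.le))]
    simp only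
    rw [listOp_pd_homPart hw hU h0 hYk, neg_add_eq_sub, ← neg_sub ((w k : ℤ) - d)]
    exact hC x hx t ht htε.le

theorem HasHomogeneousModel.vanishesTo (hU : IsOpen U) (h0 : (0 : Rn n) ∈ U)
    (hY : ContDiffOn ℝ ∞ Y U) (h : HasHomogeneousModel w U Y d) (k : Fin n) :
    VanishesTo (intWeight w) (fun x => Y x k) ((w k : ℤ) - d) := by
  obtain ⟨Z, hZ, -, hO⟩ := h
  have hYk := contDiffOn_coord hY k
  have hZk : ContDiff ℝ ∞ fun x => Z x k := (contDiff_coord k).comp hZ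
  rw [← weightGE_iff hU h0 hYk]
  intro α hα
  obtain ⟨C, hC⟩ := hO {0} isCompact_singleton (by simpa using h0) α k
  -- At the origin, fixed by all dilations, the expansion says that `t^(-q) * A - B` is `O(t)`. As
  -- `q > 0`, this forces `A = 0`.
  obtain ⟨q, hq⟩ := Int.eq_ofNat_of_zero_le (show 0 ≤ (w k : ℤ) - d - wlen w α by omega)
  have hq0 : q ≠ 0 := by omega
  set A := partialDeriv α (fun x => Y x k) 0 with hA
  set B := partialDeriv α (fun x => Z x k) 0
  have hev : ∀ᶠ t in 𝓝[≠] (0 : ℝ), |A| ≤ |t| ^ q * (C * |t| + |B|) := by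
    filter_upwards [hC, self_mem_nhdsWithin] with t hCt ht
    have ht : t ≠ 0 := ht
    have h1 := hCt 0 rfl
    rw [partialDeriv_eq_listOp, rescaled_component _ _ d ht,
      listOp_pd_rescale_sub hU hYk hZk ht _ _
        (show dilation w t 0 ∈ U by simpa using h0)] at h1
    simp only [dilation_origin] at h1
    rw [← partialDeriv_eq_listOp, ← partialDeriv_eq_listOp, ← hA] at h1
    change |_ * A - B| ≤ _ at h1
    rw [show -((w k : ℤ) - d) + ((expand α).map (intWeight w)).sum = -(q : ℤ) by
      rw [← wlen_eq_sum]; omega, zpow_neg, zpow_natCast] at h1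
    have h2 : A = t ^ q * (((t ^ q)⁻¹ * A - B) + B) := by
      have := pow_ne_zero q ht
      field_simp
      ring
    rw [h2, abs_mul, abs_pow]
    gcongr
    exact (abs_add_le _ _).trans (by gcongr)
  have hlim : Filter.Tendsto (fun t : ℝ => |t| ^ q * (C * |t| + |B|)) (𝓝[≠] 0) (𝓝 0) := by
    have hc : Continuous fun t : ℝ => |t| ^ q * (C * |t| + |B|) := by fun_prop
    have := hc.tendsto 0
    simp only [abs_zero, zero_pow hq0, zero_mul] at this
    exact this.mono_left nhdsWithin_le_nhds
  exact abs_eq_zero.1 (le_antisymm (ge_of_tendsto hlim hev) (abs_nonneg _))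

end Model

/-! ### Passing from the manifold to coordinates -/

section Transport

variable {n : ℕ} {M : Type*} [TopologicalSpace M] [ChartedSpace (Rn n) M]

variable {φ : OpenPartialHomeomorph M (Rn n)}

theorem contMDiffOn_chart (hφ : φ ∈ IsManifold.maximalAtlas (𝓡 n) ∞ M) :
    ContMDiffOn (𝓡 n) (𝓡 n) ∞ φ φ.source :=
  contMDiffOn_of_mem_maximalAtlas hφ

theorem mdifferentiableAt_chart (hφ : φ ∈ IsManifold.maximalAtlas (𝓡 n) ∞ M) {p : M}
    (hp : p ∈ φ.source) : MDifferentiableAt (𝓡 n) (𝓡 n) φ p :=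
  ((contMDiffOn_chart hφ).contMDiffAt (φ.open_source.mem_nhds hp)).mdifferentiableAt (by simp)

theorem mvfOp_eq_vfOp (hφ : φ ∈ IsManifold.maximalAtlas (𝓡 n) ∞ M)
    (X : (x : M) → TangentSpace (𝓡 n) x) {f : M → ℝ} {g : Rn n → ℝ}
    (hg : ContDiffOn ℝ ∞ g φ.target) (hfg : ∀ p ∈ φ.source, f p = g (φ p)) :
    ∀ p ∈ φ.source, mvfOp X f p = vfOp (coordVF φ X) g (φ p) := by
  intro p hp
  have hgd : DifferentiableAt ℝ g (φ p) :=
    SmoothOn.differentiableAt φ.open_target hg (φ.map_source hp)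
  have heq : f =ᶠ[𝓝 p] g ∘ φ := by
    filter_upwards [φ.open_source.mem_nhds hp] with q hq using hfg q hq
  rw [mvfOp, heq.mfderiv_eq, mfderiv_comp p hgd.mdifferentiableAt (mdifferentiableAt_chart hφ hp),
    mfderiv_eq_fderiv, vfOp, coordVF, φ.left_inv hp]
  rfl

variable [IsManifold (𝓡 n) ∞ M]

theorem CarnotStructure.rank_step (C : CarnotStructure n M) (a : M) : C.rank C.step = n := by
  obtain ⟨W, -, haW, Y, -, hY⟩ := C.isSubbundle C.step C.one_le_step le_rfl a
  obtain ⟨hli, hspan⟩ := hY a haW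
  rw [C.top a] at hspan
  have h := finrank_span_eq_card hli
  rw [hspan, finrank_top, Fintype.card_fin] at h
  rw [← h]
  exact finrank_euclideanSpace_fin (𝕜 := ℝ)

theorem CarnotStructure.one_le_weight (C : CarnotStructure n M) (a : M) (j : Fin n) :
    1 ≤ C.weight j := by
  -- Nonemptiness excludes the default `sInf ∅ = 0`; the top step qualifies because its rank is `n`.
  have hne : {v : ℕ | 1 ≤ v ∧ v ≤ C.step ∧ (j : ℕ) + 1 ≤ C.rank v}.Nonempty :=
    ⟨C.step, C.one_le_step, le_rfl, by rw [C.rank_step a]; exact j.isLt⟩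
  exact (Nat.sInf_mem hne).1

/-- The pushed-forward field is a section of the tangent bundle of the model space obtained from the
smooth composition of the tangent map of `φ`, `X` and `φ.symm`. -/
theorem contDiffOn_coordVF (hφ : φ ∈ IsManifold.maximalAtlas (𝓡 n) ∞ M)
    {X : (x : M) → TangentSpace (𝓡 n) x} (hX : SmoothVFOn X φ.source) :
    ContDiffOn ℝ ∞ (coordVF φ X) φ.target := by
  have h₁ : ContMDiffOn (𝓡 n) (𝓡 n) ∞ φ.symm φ.target :=
    contMDiffOn_symm_of_mem_maximalAtlas hφ
  have h₂ : ContMDiffOn (𝓡 n) (𝓡 n).tangent ∞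
      (fun u => (⟨φ.symm u, X (φ.symm u)⟩ : TangentBundle (𝓡 n) M)) φ.target :=
    hX.comp h₁ fun u hu => φ.map_target hu
  have : IsManifold (𝓡 n) 1 M := IsManifold.of_le (n := ∞) (by simp)
  have h₃ := (contMDiffOn_chart hφ).contMDiffOn_tangentMapWithin (m := ∞) (by simp)
    φ.open_source.uniqueMDiffOn
  have h₄ := h₃.comp h₂ fun u hu => φ.map_target hu
  intro u hu
  refine contMDiffWithinAt_vectorSpace_iff_contDiffWithinAt.1 ?_
  refine (h₄ u hu).congr_of_mem (fun v hv => ?_) hu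
  have hv' := φ.map_target hv
  simp only [Function.comp_apply, tangentMapWithin, coordVF]
  rw [mfderivWithin_of_isOpen φ.open_source hv', φ.right_inv hv]

theorem seqOp_eq_listOp (hφ : φ ∈ IsManifold.maximalAtlas (𝓡 n) ∞ M)
    {X : Fin n → (x : M) → TangentSpace (𝓡 n) x} (hX : ∀ j, SmoothVFOn (X j) φ.source)
    {f : M → ℝ} {g : Rn n → ℝ} (hg : ContDiffOn ℝ ∞ g φ.target)
    (hfg : ∀ p ∈ φ.source, f p = g (φ p)) (I : List (Fin n)) :
    ∀ p ∈ φ.source, seqOp X I f p =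
      listOp (fun i => vfOp (coordVF φ (X i))) I g (φ p) := by
  induction I with
  | nil => exact hfg
  | cons i I ih =>
    exact mvfOp_eq_vfOp hφ (X i) (contDiffOn_listOp_vfOp φ.open_target
      (fun j => contDiffOn_coordVF hφ (hX j)) hg I) ih

theorem sum_map_intWeight (w : Fin n → ℕ) (I : List (Fin n)) :
    (I.map (intWeight w)).sum = (seqWeight w I : ℤ) := by
  induction I with
  | nil => rfl
  | cons i I ih =>
    rw [List.map_cons, List.sum_cons, ih, seqWeight, seqWeight, List.map_cons, List.sum_cons]
    push_cast
    rfl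

theorem isPrivileged_iff_orderGE {a : M} (hφ : IsCenteredChart φ a) (w : Fin n → ℕ)
    {X : Fin n → (x : M) → TangentSpace (𝓡 n) x} (hX : ∀ j, SmoothVFOn (X j) φ.source)
    (hlin : LinearlyAdapted φ X) :
    IsPrivileged w φ a X ↔
      ∀ k, OrderGE w (fun j => coordVF φ (X j)) (fun x => x k) (w k) := by
  have hseq : ∀ k I, seqOp X I (fun p => φ p k) a =
      listOp (fun i => vfOp (coordVF φ (X i))) I (fun x => x k) 0 := fun k I => by
    rw [seqOp_eq_listOp hφ.mem_maximalAtlas hX (contDiff_coord k).contDiffOn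
      (fun _ _ => rfl) I a hφ.mem_source, hφ.map_eq_zero]
  constructor
  · intro h k I hI
    rw [sum_map_intWeight] at hI
    rw [← hseq]
    exact (h.2 k).1 I (by exact_mod_cast hI)
  · refine fun h => ⟨hlin, fun k => ⟨fun I hI => ?_, [k], by simp [seqWeight], ?_⟩⟩
    · rw [hseq]
      refine h k I ?_
      rw [sum_map_intWeight]
      exact_mod_cast hI
    · rw [hseq, listOp_cons, listOp_nil, vfOp_coord]
      simp [hlin k]

end Transport

end Carnot

end

/-! ### The equivalences, assembled through the component bound -/

theorem theorem5p1 {n : ℕ} {M : Type*} [TopologicalSpace M] [T2Space M]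
    [ChartedSpace (Carnot.Rn n) M] [IsManifold (𝓡 n) ∞ M]
    (C : Carnot.CarnotStructure n M) (a : M)
    (φ : OpenPartialHomeomorph M (Carnot.Rn n)) (hφ : Carnot.IsCenteredChart φ a)
    (X : Fin n → (x : M) → TangentSpace (𝓡 n) x) (hX : Carnot.IsHFrameOn C X φ.source) :
    (Carnot.LinearlyAdapted φ X →
      List.TFAE [
        Carnot.IsPrivileged C.weight φ a X,
        ∀ j, Carnot.HasHomogeneousModel C.weight φ.target (Carnot.coordVF φ (X j)) (C.weight j),
        ∀ j, Carnot.DiffOpHasWeight C.weight φ.target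
          (Carnot.vfOp (Carnot.coordVF φ (X j))) (-(C.weight j : ℤ)),
        ∀ α : Fin n → ℕ, Carnot.DiffOpHasWeight C.weight φ.target
          (Carnot.monomial (fun j => Carnot.vfOp (Carnot.coordVF φ (X j))) α)
          (-(Carnot.wlen C.weight α : ℤ))]) ∧
    (Carnot.IsPrivileged C.weight φ a X ↔ Carnot.IsGoodmanPrivileged C.weight φ X) := by
  have hU := φ.open_target
  have h0 : (0 : Carnot.Rn n) ∈ φ.target := hφ.map_eq_zero ▸ φ.map_source hφ.mem_source
  have hw := C.one_le_weight a
  have hY : ∀ j, ContDiffOn ℝ ∞ (Carnot.coordVF φ (X j)) φ.target := fun j =>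
    Carnot.contDiffOn_coordVF hφ.mem_maximalAtlas (hX.smooth j)
  have hmodel : (∀ j, Carnot.HasHomogeneousModel C.weight φ.target (Carnot.coordVF φ (X j))
      (C.weight j)) ↔ Carnot.ComponentsVanish C.weight fun j => Carnot.coordVF φ (X j) :=
    ⟨fun h j k => (h j).vanishesTo hU h0 (hY j) k,
      fun h j => Carnot.HasHomogeneousModel.of_vanishesTo hU h0 hw (hY j) (h j)⟩
  have hpriv (hlin : Carnot.LinearlyAdapted φ X) : Carnot.IsPrivileged C.weight φ a X ↔
      Carnot.ComponentsVanish C.weight fun j => Carnot.coordVF φ (X j) :=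
    (Carnot.isPrivileged_iff_orderGE hφ _ hX.smooth hlin).trans
      (Carnot.componentsVanish_iff_orderGE hU h0 hY hlin hw).symm
  refine ⟨fun hlin => ?_, fun h => ⟨h.1, hmodel.2 ((hpriv h.1).1 h)⟩,
    fun h => (hpriv h.1).2 (hmodel.1 h.2)⟩
  tfae_have 1 ↔ 2 := (hpriv hlin).trans hmodel.symm
  tfae_have 2 → 4 := fun h α => (hmodel.1 h).diffOpHasWeight_monomial hU h0 hY hlin α
  tfae_have 4 → 3 := fun h j => by
    simpa only [Carnot.monomial_single, Carnot.wlen_single] using h (Pi.single j 1)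
  tfae_have 3 → 2 := fun h => hmodel.2 (Carnot.ComponentsVanish.of_diffOpHasWeight hU h0 h)
  tfae_finish
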